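/- Let $\mathsf Z$ be a nonempty Borel subset of $\mathbb R^m$ and let $P$ be a Feller stochastic kernel on $\mathsf Z$. Let $(z_t)_{t\ge 0}$ be a Markov process with kernel $P$, and let $(\zeta_t)_{t\ge1}$ be iid with law $\nu$ and $(\eta_t)_{t\ge1}$ iid with law $\mu$, the three processes being independent. Put $R_t=R(z_t,\zeta_t)$ and $Y_t=Y(z_t,\eta_t)$, where $R,Y\ge 0$ are measurable real-valued functions. Write $\mathbb E_z$ for expectation given $z_0=z$, and $\hat z,\hat R,\hat Y$ for the next-period values, so that $\mathbb E_z f(\hat z,\hat R,\hat Y)=\int f(\hat z,R(\hat z,\zeta),Y(\hat z,\eta))\,P(z,d\hat z)\,\nu(d\zeta)\,\mu(d\eta)$. Let $\beta\in[0,1)$ and $u:[0,\infty)\to\{-\infty\}\cup\mathbb R$. We use the conventions $u'(0)=\infty$ and $0\cdot\infty=0$. Let $\mathsf S_0=(0,\infty)\times\mathsf Z$ and $\mathsf S=[0,\infty)\times \mathsf Z$. A feasible policy is a measurable $c:\mathsf S_0\to\mathbb R$ with $0\le c(a,z)\le a$; it is extended to $\mathsf S$ by $c(0,z)=0$. It generates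 wealth $a_{t+1}=R_{t+1}(a_t-c(a_t,z_t))+Y_{t+1}$ from $(a_0,z_0)=(a,z)$ and has lifetime value $V_c(a,z)=\mathbb E_{a,z}\sum_{t\ge0}\beta^t u(c(a_t,z_t))$. It is optimal if $V_d\le V_c$ on $\mathsf S_0$ for every feasible $d$. Let $\mathscr C$ be the set of continuous $c:\mathsf S_0\to\mathbb R$ that are increasing in $a$ and satisfy $0<c(a,z)\le a$ and $\sup_{\mathsf S_0}|u'(c(a,z))-u'(a)|<\infty$. Assume: 1. $u$ is twice differentiable on $(0,\infty)$ with $u'>0$, $u''<0$, $u'(x)\to\infty$ as $x\to0$, $u'(x)\to0$ as $x\to\infty$, and $u(0)\le u(x)$ for all $x>0$. 2. $\beta^n\sup_z\mathbb E_zR_1\cdots R_n<1$ for some $n\ge1$. 3. $\sum_{t\ge1}\beta^t\mathbb E_zY_t<\infty$ for all $z$. 4. $\sup_z\mathbb E_z\hat R$, $\sup_z\mathbb E_zu'(\hat Y)$ and $\sup_z\mathbb E_z\hat Ru'(\hat Y)$ are finite. 5. $z\mapsto R(z,\zeta)$ for each $\zeta$, $z\mapsto Y(z,\eta)$ for each $\eta$,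 $z\mapsto\mathbb E_z\hat R$ and $z\mapsto\mathbb E_z\hat Ru'(\hat Y)$ are continuous. 6. There is $\alpha\in(0,1)$ such that $\beta\,\mathbb E_z\hat R\,u'[\hat R(1-\alpha)a]\le u'(a)$ for all $(a,z)\in\mathsf S_0$, and $(1-\alpha)^n\sup_z\mathbb E_zR_1\cdots R_n<1$ for some $n\ge1$. 7. $\sup_{t\ge1}\mathbb E_zY_t<\infty$ for all $z$. 8. $P$ is bounded in probability, i.e. $\{P^t(z,\cdot)\}_{t\ge0}$ is tight for every $z\in\mathsf Z$. Then there is exactly one optimal policy $c^*$ in $\mathscr C$, and the stochastic kernel $Q$ on $\mathsf S$ of the state process $(a_t,z_t)$ under $c^*$ is bounded in probability (that is, $\{Q^t(s,\cdot)\}_{t\ge0}$ is tight for every $s\in\mathsf S$) and admits at least one stationary distribution (a probability measure $\psi$ on $\mathsf S$ with $\psi Q=\psi$). -/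

import Mathlib

open MeasureTheory ProbabilityTheory Filter Topology
open scoped NNReal ENNReal BoundedContinuousFunction

noncomputable section

namespace IncomeFluctuation

/-- A stochastic kernel is Feller if it maps bounded continuous functions to bounded continuous
functions (boundedness of the image is automatic for a Markov kernel). -/
def IsFeller {X : Type*} [TopologicalSpace X] [MeasurableSpace X] (P : Kernel X X) : Prop :=
  ∀ h : X →ᵇ ℝ, Continuous fun x => ∫ y, h y ∂(P x)

/-- A stochastic kernel `Q` is bounded in probability if, for every `x`, the sequence
`Q ^ t (x, ·)`, `t ≥ 0`, of `t`-step transition probabilities is tight. -/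
def BoundedInProbability {X : Type*} [TopologicalSpace X] [MeasurableSpace X]
    (Q : Kernel X X) : Prop :=
  ∀ x, IsTightMeasureSet (Set.range fun t : ℕ => (Q ^ t) x)

/-- `ψ` is a stationary distribution of `Q`: a probability measure with `ψ Q = ψ`. -/
def IsStationary {X : Type*} [MeasurableSpace X] (Q : Kernel X X) (ψ : Measure X) : Prop :=
  IsProbabilityMeasure ψ ∧ Q.Invariant ψ

/-- The primitives of the income fluctuation problem. `Z` is the space of the exogenous Markov
state, `E` and `H` are the spaces of the return innovations `ζ` and the income innovations `η`. -/
structure Model (Z E H : Type*) [TopologicalSpace Z] [MeasurableSpace Z] [MeasurableSpace E]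
    [MeasurableSpace H] where
  /-- discount factor, in `[0, 1)` -/
  β : ℝ≥0
  β_lt_one : β < 1
  /-- utility, with values in `{-∞} ∪ ℝ` by the assumption `Utility` below -/
  u : ℝ≥0 → EReal
  /-- transition kernel of the exogenous state -/
  P : Kernel Z Z
  markov_P : IsMarkovKernel P
  feller_P : IsFeller P
  /-- law of the return innovations -/
  ν : Measure E
  prob_ν : IsProbabilityMeasure ν
  /-- law of the income innovations -/
  μ : Measure H
  prob_μ : IsProbabilityMeasure μ
  /-- gross return on wealth, as a function of `(z, ζ)` -/
  R : Z × E → ℝ≥0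
  measurable_R : Measurable R
  /-- labor income, as a function of `(z, η)` -/
  Y : Z × H → ℝ≥0
  measurable_Y : Measurable Y

namespace Model

variable {Z E H : Type*} [TopologicalSpace Z] [MeasurableSpace Z] [MeasurableSpace E]
  [MeasurableSpace H] (M : Model Z E H)

instance : IsMarkovKernel M.P := M.markov_P
instance : IsProbabilityMeasure M.ν := M.prob_ν
instance : IsProbabilityMeasure M.μ := M.prob_μ

/-- Return at the shock `w = (z, ζ, η)`. -/
def ret (w : Z × E × H) : ℝ≥0 := M.R (w.1, w.2.1)

/-- Income at the shock `w = (z, ζ, η)`. -/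
def inc (w : Z × E × H) : ℝ≥0 := M.Y (w.1, w.2.2)

lemma measurable_ret : Measurable M.ret :=
  M.measurable_R.comp (by fun_prop)

lemma measurable_inc : Measurable M.inc :=
  M.measurable_Y.comp (by fun_prop)

/-- The law `P(z, dẑ) ν(dζ̂) μ(dη̂)` of the next period's `(ẑ, ζ̂, η̂)` given the current `z`. -/
def shock : Kernel Z (Z × E × H) := M.P ×ₖ Kernel.const Z (M.ν.prod M.μ)

instance : IsMarkovKernel M.shock := by unfold shock; infer_instance

/-- The law of the exogenous process `(z_t, ζ_t, η_t)`, `t ≥ 0`, given `z_0 = z`: `z_t` is a Markov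
process with kernel `P`, the innovations are iid with laws `ν` and `μ`, and everything is
independent. The time-zero innovations are never used. -/
def pathLaw (z : Z) : Measure (ℕ → Z × E × H) :=
  Kernel.trajMeasure (X := fun _ => Z × E × H) ((Measure.dirac z).prod (M.ν.prod M.μ))
    (fun n => M.shock.comap (fun h => (h ⟨n, Finset.mem_Iic.2 le_rfl⟩).1) (by fun_prop))

/-- `𝔼_z f(ẑ, ζ̂, η̂)` for a function of the next period's shocks. -/
def E1 (z : Z) (f : Z × E × H → ℝ≥0∞) : ℝ≥0∞ := ∫⁻ w, f w ∂(M.shock z)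

/-- `𝔼_z f` for a function of the whole exogenous path. -/
def Epath (z : Z) (f : (ℕ → Z × E × H) → ℝ≥0∞) : ℝ≥0∞ := ∫⁻ ω, f ω ∂(M.pathLaw z)

/-- `𝔼_z R_1 ⋯ R_n`. -/
def expRetProd (n : ℕ) (z : Z) : ℝ≥0∞ :=
  M.Epath z fun ω => ∏ i ∈ Finset.Icc 1 n, (M.ret (ω i) : ℝ≥0∞)

/-- `𝔼_z Y_t`, meant for `t ≥ 1`. -/
def expInc (t : ℕ) (z : Z) : ℝ≥0∞ := M.Epath z fun ω => (M.inc (ω t) : ℝ≥0∞)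

/-- The real-valued version of `u`, used on `(0, ∞)` only. -/
def uReal (x : ℝ) : ℝ := (M.u x.toNNReal).toReal

/-- Marginal utility `u'`, with `u'(0) = ∞`. -/
def u' (x : ℝ≥0) : ℝ≥0∞ := if x = 0 then ⊤ else ENNReal.ofReal (deriv M.uReal x)

/-! ### Assumptions on the primitives -/

/-- `u : ℝ₊ → {-∞} ∪ ℝ` is increasing at zero and twice differentiable on `(0, ∞)`, with `u' > 0`,
`u'' < 0`, `u'(0+) = ∞` and `u'(∞) = 0`. -/
structure Utility : Prop where
  ne_top : ∀ x, M.u x ≠ ⊤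
  ne_bot : ∀ x, 0 < x → M.u x ≠ ⊥
  zero_le : ∀ x, M.u 0 ≤ M.u x
  differentiable : ∀ x : ℝ, 0 < x → DifferentiableAt ℝ M.uReal x
  differentiable_deriv : ∀ x : ℝ, 0 < x → DifferentiableAt ℝ (deriv M.uReal) x
  deriv_pos : ∀ x : ℝ, 0 < x → 0 < deriv M.uReal x
  deriv2_neg : ∀ x : ℝ, 0 < x → deriv (deriv M.uReal) x < 0
  tendsto_zero : Tendsto (deriv M.uReal) (𝓝[>] 0) atTop
  tendsto_top : Tendsto (deriv M.uReal) atTop (𝓝 0)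

/-- For some `n ≥ 1`, `β ^ n sup_z 𝔼_z R_1 ⋯ R_n < 1`. -/
def ReturnGrowth : Prop :=
  ∃ n : ℕ, 1 ≤ n ∧ (M.β : ℝ≥0∞) ^ n * (⨆ z, M.expRetProd n z) < 1

/-- For all `z`, `∑_{t ≥ 1} β ^ t 𝔼_z Y_t < ∞`. -/
def DiscountedIncome : Prop :=
  ∀ z, (∑' t : ℕ, (M.β : ℝ≥0∞) ^ (t + 1) * M.expInc (t + 1) z) < ⊤

/-- `𝔼_z R̂`, `𝔼_z u'(Ŷ)` and `𝔼_z R̂ u'(Ŷ)` are bounded in `z`. -/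
structure BoundedMoments : Prop where
  ret : (⨆ z, M.E1 z (fun w => M.ret w)) < ⊤
  marg : (⨆ z, M.E1 z (fun w => M.u' (M.inc w))) < ⊤
  ret_marg : (⨆ z, M.E1 z (fun w => M.ret w * M.u' (M.inc w))) < ⊤

/-- Continuity in `z` of `R(z, ζ)`, `Y(z, η)`, `𝔼_z R̂` and `𝔼_z R̂ u'(Ŷ)`. -/
structure ContinuousPrimitives : Prop where
  R : ∀ ζ, Continuous fun z => M.R (z, ζ)
  Y : ∀ η, Continuous fun z => M.Y (z, η)
  ret : Continuous fun z => M.E1 z (fun w => M.ret w)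
  ret_marg : Continuous fun z => M.E1 z (fun w => M.ret w * M.u' (M.inc w))

/-- The patience condition: for some `α ∈ (0, 1)`, `β 𝔼_z R̂ u'(R̂ (1 - α) a) ≤ u'(a)` for all
`a > 0` and `z` (with `0 · ∞ = 0`), and `(1 - α) ^ n sup_z 𝔼_z R_1 ⋯ R_n < 1` for some `n ≥ 1`. -/
def Patience : Prop :=
  ∃ α : ℝ≥0, 0 < α ∧ α < 1 ∧
    (∀ (a : ℝ≥0) (z : Z), 0 < a →
      M.β * M.E1 z (fun w => M.ret w * M.u' (M.ret w * (1 - α) * a)) ≤ M.u' a) ∧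
    ∃ n : ℕ, 1 ≤ n ∧ ((1 - α : ℝ≥0) : ℝ≥0∞) ^ n * (⨆ z, M.expRetProd n z) < 1

/-- For all `z`, `sup_{t ≥ 1} 𝔼_z Y_t < ∞`. -/
def BoundedIncome : Prop := ∀ z, (⨆ t : ℕ, M.expInc (t + 1) z) < ⊤

end Model

/-- A feasible policy: a measurable `c` on `(0, ∞) × Z` with `0 ≤ c(a, z) ≤ a`, extended to
`[0, ∞) × Z` by `c(0, z) = 0` (the constraint `c(a, z) ≤ a` forces this value). -/
@[ext]
structure Policy (Z : Type*) [MeasurableSpace Z] where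
  /-- consumption at `(a, z)` -/
  toFun : ℝ≥0 × Z → ℝ≥0
  measurable' : Measurable toFun
  le' : ∀ s, toFun s ≤ s.1

namespace Model

variable {Z E H : Type*} [TopologicalSpace Z] [MeasurableSpace Z] [MeasurableSpace E]
  [MeasurableSpace H] (M : Model Z E H)

/-- Next period's state `(â, ẑ)`, `â = R̂ (a - c(a, z)) + Ŷ`, given the state `s = (a, z)` and the
shock `w = (ẑ, ζ̂, η̂)`. -/
def step (c : Policy Z) (s : ℝ≥0 × Z) (w : Z × E × H) : ℝ≥0 × Z :=
  (M.ret w * (s.1 - c.toFun s) + M.inc w, w.1)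

lemma measurable_step (c : Policy Z) :
    Measurable fun p : (ℝ≥0 × Z) × (Z × E × H) => M.step c p.1 p.2 := by
  have h1 : Measurable fun p : (ℝ≥0 × Z) × (Z × E × H) => M.ret p.2 :=
    M.measurable_ret.comp measurable_snd
  have h2 : Measurable fun p : (ℝ≥0 × Z) × (Z × E × H) => M.inc p.2 :=
    M.measurable_inc.comp measurable_snd
  have h3 : Measurable fun p : (ℝ≥0 × Z) × (Z × E × H) => c.toFun p.1 :=
    c.measurable'.comp measurable_fst
  have h4 : Measurable fun p : (ℝ≥0 × Z) × (Z × E × H) => p.1.1 := by fun_prop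
  have h5 : Measurable fun p : (ℝ≥0 × Z) × (Z × E × H) => p.2.1 := by fun_prop
  exact ((h1.mul (h4.sub h3)).add h2).prodMk h5

/-- The state `(a_t, z_t)` along the exogenous path `ω` under the policy `c`, with `a_0 = a`. -/
def state (c : Policy Z) (a : ℝ≥0) (ω : ℕ → Z × E × H) : ℕ → ℝ≥0 × Z
  | 0 => (a, (ω 0).1)
  | t + 1 => M.step c (state c a ω t) (ω (t + 1))

/-- The lifetime value `V_c(a, z) = 𝔼_{a,z} ∑_{t ≥ 0} β ^ t u(c(a_t, z_t))`, as the expectation of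
the positive part minus the expectation of the negative part. -/
def value (c : Policy Z) (s : ℝ≥0 × Z) : EReal :=
  ((M.Epath s.2 fun ω => ∑' t : ℕ,
      (M.β : ℝ≥0∞) ^ t * (M.u (c.toFun (M.state c s.1 ω t))).toENNReal : ℝ≥0∞) : EReal) -
  ((M.Epath s.2 fun ω => ∑' t : ℕ,
      (M.β : ℝ≥0∞) ^ t * (-M.u (c.toFun (M.state c s.1 ω t))).toENNReal : ℝ≥0∞) : EReal)

/-- `c` is optimal: it maximizes lifetime value at every `(a, z) ∈ (0, ∞) × Z` among all feasible
policies. -/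
def IsOptimal (c : Policy Z) : Prop :=
  ∀ d : Policy Z, ∀ s : ℝ≥0 × Z, 0 < s.1 → M.value d s ≤ M.value c s

/-- The class of candidate policies: on `(0, ∞) × Z`, `c` is continuous, increasing in wealth,
strictly positive, and `u' ∘ c` is at bounded distance from `u'(a)`. -/
structure Candidate (c : Policy Z) : Prop where
  continuousOn : ContinuousOn c.toFun {s | 0 < s.1}
  mono : ∀ (a b : ℝ≥0) (z : Z), 0 < a → a ≤ b → c.toFun (a, z) ≤ c.toFun (b, z)
  pos : ∀ s, 0 < s.1 → 0 < c.toFun s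
  bounded : ∃ K : ℝ, ∀ s : ℝ≥0 × Z, 0 < s.1 →
    |deriv M.uReal (c.toFun s) - deriv M.uReal s.1| ≤ K

/-- The stochastic kernel `Q` of the state process `(a_t, z_t)` under the policy `c`: `Q(s, ·)` is
the law of the next state given the current state `s`. -/
def stateKernel (c : Policy Z) : Kernel (ℝ≥0 × Z) (ℝ≥0 × Z) :=
  (Kernel.id ×ₖ M.shock.comap Prod.snd measurable_snd).map fun p => M.step c p.1 p.2

lemma stateKernel_apply (c : Policy Z) (s : ℝ≥0 × Z) :
    M.stateKernel c s = (M.shock s.2).map (M.step c s) := by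
  have h := M.measurable_step c
  rw [stateKernel, Kernel.map_apply _ h, Kernel.prod_apply, Kernel.id_apply, Kernel.comap_apply,
    Measure.dirac_prod, Measure.map_map h (by fun_prop)]
  rfl

instance (c : Policy Z) : IsMarkovKernel (M.stateKernel c) :=
  Kernel.IsMarkovKernel.map _ (M.measurable_step c)

end Model

end IncomeFluctuation

end

/-!
Work with the marginal value of wealth `p = u' ∘ c`. The Euler equation says that `p` is a fixed
point of the time iteration operator, which sends `p` to the crossing of the functions
`k ↦ β 𝔼_z R̂ p(R̂ k + Ŷ, ẑ)` and `k ↦ u'(a - k)`. Starting from `u'` the iterates increase, and by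
the growth condition on returns consecutive ones differ by a summable geometric series in a norm
weighted by `∑_{i < n} β ^ i 𝔼_z R_1 ⋯ R_i`. Their limit is a continuous fixed point at bounded
distance from `u'`, hence comes from a candidate policy `c`.

For any feasible `d`, concavity bounds the gain of `d` over `c` by the discounted sum of
`𝔼 u'(c_t) (d_t - c_t)`. The Euler equation makes this sum telescope, with a remainder that vanishes
by transversality, so `c` is optimal; strict concavity at the first period makes it the only one.

The patience condition passes through the iteration and gives `c(a, z) ≥ α a`, so mean wealth,
weighted as before with `1 - α` in place of `β`, satisfies an affine recursion with slope below one.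
Bounded mean wealth is tightness, and a Feller kernel with a tight orbit has a stationary law by
averaging along the orbit.
-/

noncomputable section

namespace IncomeFluctuation

/-! ### Sequences of extended nonnegative numbers -/

lemma exists_eq_add_mul {x : ℝ≥0∞} (hx : x < ⊤) {l : ℝ≥0} (hl : l < 1) :
    ∃ X < (⊤ : ℝ≥0∞), X = x + l * X := by
  lift x to ℝ≥0 using hx.ne
  have hpos : 0 < 1 - l := tsub_pos_of_lt hl
  refine ⟨(x / (1 - l) : ℝ≥0), ENNReal.coe_lt_top, ?_⟩
  norm_cast
  calc x / (1 - l) = (1 - l) * (x / (1 - l)) + l * (x / (1 - l)) := by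
        rw [← add_mul, tsub_add_cancel_of_le hl.le, one_mul]
    _ = x + l * (x / (1 - l)) := by rw [mul_div_cancel₀ _ hpos.ne']

lemma exists_bound_of_succ_le {m : ℕ → ℝ≥0∞} {W : ℝ≥0∞} {l : ℝ≥0} (hl : l < 1) (h0 : m 0 < ⊤)
    (hW : W < ⊤) (h : ∀ t, m (t + 1) ≤ l * m t + W) : ∃ X < (⊤ : ℝ≥0∞), ∀ t, m t ≤ X := by
  obtain ⟨X, hXt, hX⟩ := exists_eq_add_mul (ENNReal.add_lt_top.2 ⟨h0, hW⟩) hl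
  refine ⟨X, hXt, fun t => ?_⟩
  induction t with
  | zero => rw [hX, add_assoc]; exact le_self_add
  | succ t ih =>
    calc m (t + 1) ≤ l * m t + W := h t
      _ ≤ l * X + W := by gcongr
      _ ≤ m 0 + W + l * X := by rw [add_comm (_ * _), add_assoc]; exact le_add_self
      _ = X := hX.symm

lemma tsum_lt_top_of_succ_le {m y : ℕ → ℝ≥0∞} {l : ℝ≥0} (hl : l < 1) (h0 : m 0 < ⊤)
    (hy : ∑' t, y t < ⊤) (h : ∀ t, m (t + 1) ≤ l * m t + y t) : ∑' t, m t < ⊤ := by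
  obtain ⟨X, hXt, hX⟩ := exists_eq_add_mul (ENNReal.add_lt_top.2 ⟨h0, hy⟩) hl
  refine (ENNReal.tsum_le_of_sum_range_le fun n => ?_).trans_lt hXt
  induction n with
  | zero => simp
  | succ n ih =>
    calc ∑ t ∈ Finset.range (n + 1), m t
        = m 0 + ∑ t ∈ Finset.range n, m (t + 1) := by rw [Finset.sum_range_succ', add_comm]
      _ ≤ m 0 + ∑ t ∈ Finset.range n, (l * m t + y t) := by gcongr with t; exact h t
      _ = m 0 + ∑ t ∈ Finset.range n, y t + l * ∑ t ∈ Finset.range n, m t := by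
          rw [Finset.sum_add_distrib, ← Finset.mul_sum]
          ring
      _ ≤ m 0 + ∑' t, y t + l * X := by gcongr; exact ENNReal.sum_le_tsum _
      _ = X := hX.symm

lemma tsum_le_tsum_of_add_le_add {f g C D A : ℕ → ℝ≥0∞} (h : ∀ t, f t + C t ≤ g t + D t)
    (hD : ∀ T, ∑ t ∈ Finset.range T, D t ≤ ∑ t ∈ Finset.range T, C t + A T)
    (hC : ∀ t, C t ≠ ⊤) (hA : Tendsto A atTop (𝓝 0)) : ∑' t, f t ≤ ∑' t, g t := by
  have hpartial (T : ℕ) : ∑ t ∈ Finset.range T, f t ≤ ∑' t, g t + A T := by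
    have hfin : ∑ t ∈ Finset.range T, C t ≠ ⊤ := ENNReal.sum_ne_top.2 fun t _ => hC t
    refine (ENNReal.add_le_add_iff_right hfin).1 ?_
    calc ∑ t ∈ Finset.range T, f t + ∑ t ∈ Finset.range T, C t
        ≤ ∑ t ∈ Finset.range T, g t + ∑ t ∈ Finset.range T, D t := by
          simpa only [Finset.sum_add_distrib] using Finset.sum_le_sum fun t _ => h t
      _ ≤ ∑' t, g t + (∑ t ∈ Finset.range T, C t + A T) :=
          add_le_add (ENNReal.sum_le_tsum _) (hD T)
      _ = ∑' t, g t + A T + ∑ t ∈ Finset.range T, C t := by ring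
  refine le_of_tendsto_of_tendsto' (ENNReal.tendsto_nat_tsum f) ?_ hpartial
  simpa using tendsto_const_nhds.add hA

lemma coe_sub_le_coe_sub {p n q m : ℝ≥0∞} (hm : m ≠ ⊤) (h : p + m ≤ q + n) :
    (p : EReal) - n ≤ q - m := by
  refine EReal.sub_le_of_le_add ?_
  rw [sub_eq_add_neg, add_right_comm, ← sub_eq_add_neg, EReal.le_sub_iff_add_le (by simp)
    (.inl (by simpa using hm))]
  exact_mod_cast h

lemma coe_sub_lt_coe_sub {p n q m : ℝ≥0∞} (hm : m ≠ ⊤) (h : p + m < q + n) :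
    (p : EReal) - n < q - m := by
  refine EReal.sub_lt_of_lt_add ?_
  rw [sub_eq_add_neg, add_right_comm, ← sub_eq_add_neg, EReal.lt_sub_iff_add_lt (by simp)
    (.inl (by simpa using hm))]
  exact_mod_cast h

lemma tendsto_mul_pow_mul_zero {C r : ℝ≥0∞} {l : ℝ≥0} (hC : C ≠ ⊤) (hr : r ≠ ⊤) (hl : l < 1) :
    Tendsto (fun n : ℕ => C * (l : ℝ≥0∞) ^ n * r) atTop (𝓝 0) := by
  have hpow : Tendsto (fun n : ℕ => (l : ℝ≥0∞) ^ n) atTop (𝓝 0) :=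
    ENNReal.tendsto_pow_atTop_nhds_zero_of_lt_one (by exact_mod_cast hl)
  simpa using ENNReal.Tendsto.mul_const (ENNReal.Tendsto.const_mul hpow (.inr hC)) (.inr hr)

/-! ### Continuity and semicontinuity -/

lemma continuous_of_strictAnti_comp {X α γ : Type*} [TopologicalSpace X] [LinearOrder α]
    [TopologicalSpace α] [OrderTopology α] [LinearOrder γ] [TopologicalSpace γ]
    [OrderClosedTopology γ] {f : X → α} {g : α → γ} (hg : StrictAnti g)
    (h : Continuous fun x => g (f x)) : Continuous f := by
  rw [continuous_iff_lower_upperSemicontinuous]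
  refine ⟨fun x y hy => ?_, fun x y hy => ?_⟩
  · filter_upwards [(h.tendsto x).eventually_lt_const (hg hy)] with x' hx'
    exact hg.lt_iff_gt.1 hx'
  · filter_upwards [(h.tendsto x).eventually_const_lt (hg hy)] with x' hx'
    exact hg.lt_iff_gt.1 hx'

lemma continuous_iSup_of_le_add {X : Type*} [TopologicalSpace X] {f : ℕ → X → ℝ≥0∞}
    {ε : ℕ → ℝ≥0∞} (hf : ∀ n, Continuous (f n)) (hε : Tendsto ε atTop (𝓝 0))
    (h : ∀ m n x, f m x ≤ f n x + ε n) : Continuous fun x => ⨆ n, f n x := by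
  rw [continuous_iff_lower_upperSemicontinuous]
  refine ⟨lowerSemicontinuous_iSup fun n => (hf n).lowerSemicontinuous, fun x y hy => ?_⟩
  have hlim : Tendsto (fun n => (⨆ n, f n x) + ε n) atTop (𝓝 (⨆ n, f n x)) := by
    simpa using (tendsto_const_nhds (x := ⨆ n, f n x)).add hε
  obtain ⟨n, hn⟩ := (hlim.eventually_lt_const hy).exists
  have hnx : f n x + ε n < y := (add_le_add (le_iSup (fun n => f n x) n) le_rfl).trans_lt hn
  filter_upwards [(((hf n).add continuous_const).tendsto x).eventually_lt_const hnx] with x' hx'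
  exact (iSup_le fun m => h m n x').trans_lt hx'

section LowerSemicontinuity

lemma lowerSemicontinuous_lintegral_param {X T : Type*} [TopologicalSpace X]
    [FirstCountableTopology X] [MeasurableSpace T] {ν : Measure T} {F : X → T → ℝ≥0∞}
    (hm : ∀ x, Measurable (F x)) (h : ∀ t, LowerSemicontinuous fun x => F x t) :
    LowerSemicontinuous fun x => ∫⁻ t, F x t ∂ν := by
  rw [lowerSemicontinuous_iff_le_liminf]
  intro x
  calc ∫⁻ t, F x t ∂ν ≤ ∫⁻ t, liminf (fun x' => F x' t) (𝓝 x) ∂ν :=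
        lintegral_mono fun t => lowerSemicontinuous_iff_le_liminf.1 (h t) x
    _ ≤ liminf (fun x' => ∫⁻ t, F x' t ∂ν) (𝓝 x) := lintegral_liminf_le hm

variable {X Ω : Type*} [TopologicalSpace X] [TopologicalSpace Ω] [MeasurableSpace Ω]
  [BorelSpace Ω] {μ : X → ProbabilityMeasure Ω}

-- Layer-cake formula, portmanteau on the open superlevel sets, then Fatou in the level.
lemma lowerSemicontinuous_lintegral_ofReal [FirstCountableTopology X] [HasOuterApproxClosed Ω]
    (hμ : Continuous μ) {f : Ω → ℝ} (hf0 : ∀ y, 0 ≤ f y) (hf : LowerSemicontinuous f) :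
    LowerSemicontinuous fun x => ∫⁻ y, ENNReal.ofReal (f y) ∂(μ x : Measure Ω) := by
  simp_rw [lintegral_eq_lintegral_meas_lt _ (Eventually.of_forall hf0) hf.measurable.aemeasurable]
  refine lowerSemicontinuous_lintegral_param (fun x => ?_) (fun t => ?_)
  · exact Antitone.measurable fun s t hst => measure_mono fun y hy => lt_of_le_of_lt hst hy
  · exact lowerSemicontinuous_iff_le_liminf.2 fun x =>
      ProbabilityMeasure.le_liminf_measure_open_of_tendsto (hμ.tendsto x) (hf.isOpen_preimage t)

lemma lowerSemicontinuous_lintegral_measure [FirstCountableTopology X] [HasOuterApproxClosed Ω]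
    (hμ : Continuous μ) {f : Ω → ℝ≥0∞} (hf : LowerSemicontinuous f) :
    LowerSemicontinuous fun x => ∫⁻ y, f y ∂(μ x : Measure Ω) := by
  have hne (n : ℕ) (y : Ω) : min (n : ℝ≥0∞) (f y) ≠ ⊤ :=
    ((min_le_left _ _).trans_lt (ENNReal.natCast_lt_top n)).ne
  have hsup (y : Ω) : f y = ⨆ n : ℕ, ENNReal.ofReal (ENNReal.truncateToReal n (f y)) := by
    simp_rw [ENNReal.truncateToReal, ENNReal.ofReal_toReal (hne _ y)]
    exact (top_inf_eq _).symm.trans (by rw [← ENNReal.iSup_natCast]; exact iSup_inf_eq _ _)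
  have htrunc (n : ℕ) : LowerSemicontinuous fun y => ENNReal.truncateToReal n (f y) :=
    (ENNReal.continuous_truncateToReal (ENNReal.natCast_ne_top n)).comp_lowerSemicontinuous hf
      (ENNReal.monotone_truncateToReal (ENNReal.natCast_ne_top n))
  have hlim (x : X) : ∫⁻ y, f y ∂(μ x : Measure Ω) =
      ⨆ n : ℕ, ∫⁻ y, ENNReal.ofReal (ENNReal.truncateToReal n (f y)) ∂(μ x : Measure Ω) := by
    rw [← lintegral_iSup (fun n => (htrunc n).measurable.ennreal_ofReal), lintegral_congr hsup]
    intro m n hmn y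
    refine ENNReal.ofReal_le_ofReal (ENNReal.toReal_mono (hne n y) ?_)
    exact min_le_min_right _ (by exact_mod_cast hmn)
  simp_rw [hlim]
  exact lowerSemicontinuous_iSup fun n =>
    lowerSemicontinuous_lintegral_ofReal hμ (fun _ => ENNReal.truncateToReal_nonneg) (htrunc n)

lemma lowerSemicontinuous_lintegral_joint [TopologicalSpace.PseudoMetrizableSpace X]
    [SecondCountableTopology X] [MeasurableSpace X] [BorelSpace X]
    [TopologicalSpace.PseudoMetrizableSpace Ω] [SecondCountableTopology Ω]
    (hμ : Continuous μ) {f : X × Ω → ℝ≥0∞} (hf : LowerSemicontinuous f) :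
    LowerSemicontinuous fun x => ∫⁻ y, f (x, y) ∂(μ x : Measure Ω) := by
  have hc : Continuous fun x => (diracProba x).prod (μ x) :=
    ProbabilityMeasure.continuous_prod.comp (continuous_diracProba.prodMk hμ)
  convert lowerSemicontinuous_lintegral_measure hc hf using 2 with x
  change _ = ∫⁻ p, f p ∂((Measure.dirac x).prod (μ x : Measure Ω))
  rw [Measure.dirac_prod, lintegral_map hf.measurable (by fun_prop)]

lemma lowerSemicontinuous_coe_mul {r : X → ℝ≥0} {g : X → ℝ≥0∞} (hr : Continuous r)
    (hg : LowerSemicontinuous g) : LowerSemicontinuous fun x => (r x : ℝ≥0∞) * g x := by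
  intro x y hy
  have hr' : Tendsto (fun x' => (r x' : ℝ≥0∞)) (𝓝 x) (𝓝 (r x)) :=
    (ENNReal.continuous_coe.comp hr).tendsto x
  have hr0 : (r x : ℝ≥0∞) ≠ 0 := fun h => by simp [h] at hy
  have hdiv {x' : X} (h : (r x' : ℝ≥0∞) ≠ 0) : y / r x' < g x' ↔ y < r x' * g x' := by
    rw [ENNReal.div_lt_iff (Or.inl h) (Or.inl ENNReal.coe_ne_top), mul_comm]
  obtain ⟨b, hyb, hbg⟩ := exists_between ((hdiv hr0).2 hy)
  filter_upwards [(ENNReal.Tendsto.const_div hr' (Or.inl ENNReal.coe_ne_top)).eventually_lt_const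
    hyb, hg x b hbg, hr'.eventually_ne hr0] with x' hyb' hbg' hr0'
  exact (hdiv hr0').1 (hyb'.trans hbg')

lemma lowerSemicontinuous_ennreal_sub {f g : X → ℝ≥0∞} (hf : Continuous f) (hg : Continuous g) :
    LowerSemicontinuous fun x => f x - g x := by
  intro x y hy
  have hgx : g x ≠ ⊤ := fun h => by simp [h] at hy
  exact (ENNReal.Tendsto.sub (hf.tendsto x) (hg.tendsto x) (Or.inr hgx)).eventually_const_lt hy

lemma continuous_of_lowerSemicontinuous_add {f g : X → ℝ≥0∞} (hf : LowerSemicontinuous f)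
    (hg : LowerSemicontinuous g) (hfg : Continuous fun x => f x + g x)
    (hfin : ∀ x, f x + g x ≠ ⊤) : Continuous f := by
  rw [continuous_iff_lower_upperSemicontinuous]
  refine ⟨hf, fun x y hy => ?_⟩
  obtain ⟨m, hm, hmy⟩ := exists_between hy
  have hgx : g x ≠ ⊤ := fun h => hfin x (by simp [h])
  have hsum : f x + g x < m + g x := (ENNReal.add_lt_add_iff_right hgx).2 hm
  have hlow : ∀ᶠ x' in 𝓝 x, g x ≤ g x' + (y - m) := by
    rcases eq_or_ne (g x) 0 with h0 | h0
    · simp [h0]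
    · filter_upwards [hg x _ (ENNReal.sub_lt_self hgx h0 (tsub_pos_of_lt hmy).ne')] with x' hx'
      exact tsub_le_iff_right.1 hx'.le
  filter_upwards [(hfg.tendsto x).eventually_lt_const hsum, hlow] with x' hsum' hlow'
  refine lt_of_add_lt_add_right (a := g x') ?_
  calc f x' + g x' < m + g x := hsum'
    _ ≤ m + (g x' + (y - m)) := by gcongr
    _ = y + g x' := by rw [add_left_comm, add_tsub_cancel_of_le hmy.le, add_comm]

end LowerSemicontinuity

/-! ### Feller kernels and stationary distributions -/

lemma isTightMeasureSet_of_lintegral_le {Ω : Type*} [TopologicalSpace Ω] [MeasurableSpace Ω]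
    {S : Set (Measure Ω)} {f : Ω → ℝ≥0∞} (hf : Measurable f)
    (hcompact : ∀ N : ℝ≥0, IsCompact {x | f x ≤ N}) {X : ℝ≥0∞} (hX : X < ⊤)
    (h : ∀ ξ ∈ S, ∫⁻ x, f x ∂ξ ≤ X) : IsTightMeasureSet S := by
  rw [isTightMeasureSet_iff_exists_isCompact_measure_compl_le]
  intro ε hε
  have hlim : Tendsto (fun N : ℕ => X / (N : ℝ≥0∞)) atTop (𝓝 0) := by
    simpa using ENNReal.Tendsto.const_div ENNReal.tendsto_nat_nhds_top (.inr hX.ne)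
  obtain ⟨N, hN, hN0⟩ := ((hlim.eventually_lt_const hε).and (eventually_gt_atTop 0)).exists
  refine ⟨{x | f x ≤ N}, by simpa using hcompact N, fun ξ hξ => ?_⟩
  calc ξ {x | f x ≤ N}ᶜ ≤ ξ {x | N ≤ f x} := measure_mono fun x (hx : ¬f x ≤ N) => (not_le.1 hx).le
    _ ≤ (∫⁻ x, f x ∂ξ) / N := meas_ge_le_lintegral_div hf.aemeasurable
        (Nat.cast_ne_zero.2 hN0.ne') (ENNReal.natCast_ne_top N)
    _ ≤ X / N := ENNReal.div_le_div_right (h ξ hξ) _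
    _ ≤ ε := hN.le

section Feller

variable {X : Type*} [MeasurableSpace X] {Q : Kernel X X}

lemma pow_succ_apply_eq_bind (x : X) (t : ℕ) : (Q ^ (t + 1)) x = ((Q ^ t) x).bind Q := by
  rw [pow_succ']
  exact Kernel.comp_apply _ _ _

variable [IsMarkovKernel Q]

variable (Q) in
/-- `Q(x, ·)` as an element of the space of probability measures with its weak topology. -/
def transitionProb (x : X) : ProbabilityMeasure X := ⟨Q x, inferInstance⟩

lemma isFeller_iff_continuous_transitionProb [TopologicalSpace X] [OpensMeasurableSpace X] :
    IsFeller Q ↔ Continuous (transitionProb Q) :=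
  (ProbabilityMeasure.continuous_iff_forall_continuous_integral (μs := transitionProb Q)).symm

lemma isFeller_of_forall_isOpen_lowerSemicontinuous [TopologicalSpace X] [OpensMeasurableSpace X]
    [FirstCountableTopology X] (h : ∀ G : Set X, IsOpen G → LowerSemicontinuous fun x => Q x G) :
    IsFeller Q := by
  refine isFeller_iff_continuous_transitionProb.2 (continuous_iff_continuousAt.2 fun x => ?_)
  exact tendsto_of_forall_isOpen_le_liminf' fun G hG =>
    lowerSemicontinuous_iff_le_liminf.1 (h G hG) x

instance isMarkovKernel_pow (t : ℕ) : IsMarkovKernel (Q ^ t) := by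
  induction t with
  | zero => exact inferInstanceAs (IsMarkovKernel Kernel.id)
  | succ t ih => rw [pow_succ]; exact inferInstanceAs (IsMarkovKernel ((Q ^ t) ∘ₖ Q))

variable (Q) in
/-- The average `(n + 1)⁻¹ ∑_{t ≤ n} Q ^ t (x, ·)` of the first `n + 1` transition
probabilities, whose limit points are stationary when `Q` is Feller. -/
def occupationProb (x : X) (n : ℕ) : ProbabilityMeasure X :=
  ⟨((n + 1 : ℕ) : ℝ≥0∞)⁻¹ • ∑ t ∈ Finset.range (n + 1), (Q ^ t) x, ⟨by
    simpa using ENNReal.inv_mul_cancel (by simp) (ENNReal.natCast_ne_top (n + 1))⟩⟩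

variable [TopologicalSpace X]

lemma isTightMeasureSet_range_occupationProb {x : X}
    (h : IsTightMeasureSet (Set.range fun t : ℕ => (Q ^ t) x)) :
    IsTightMeasureSet {(p : Measure X) | p ∈ Set.range (occupationProb Q x)} := by
  rw [isTightMeasureSet_iff_exists_isCompact_measure_compl_le] at h ⊢
  intro ε hε
  obtain ⟨K, hK, hKε⟩ := h ε hε
  refine ⟨K, hK, ?_⟩
  rintro _ ⟨_, ⟨n, rfl⟩, rfl⟩
  change (((n + 1 : ℕ) : ℝ≥0∞)⁻¹ • ∑ t ∈ Finset.range (n + 1), (Q ^ t) x) Kᶜ ≤ ε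
  calc (((n + 1 : ℕ) : ℝ≥0∞)⁻¹ • ∑ t ∈ Finset.range (n + 1), (Q ^ t) x) Kᶜ
      = ((n + 1 : ℕ) : ℝ≥0∞)⁻¹ * ∑ t ∈ Finset.range (n + 1), (Q ^ t) x Kᶜ := by
        rw [Measure.smul_apply, Measure.finsetSum_apply, smul_eq_mul]
    _ ≤ ((n + 1 : ℕ) : ℝ≥0∞)⁻¹ * ∑ _t ∈ Finset.range (n + 1), ε := by
        gcongr
        exact hKε _ ⟨t, rfl⟩
    _ = ε := by
        rw [Finset.sum_const, Finset.card_range, nsmul_eq_mul, ← mul_assoc,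
          ENNReal.inv_mul_cancel (by simp) (ENNReal.natCast_ne_top _), one_mul]

variable [OpensMeasurableSpace X]

lemma integral_occupationProb (x : X) (n : ℕ) (h : X →ᵇ ℝ) :
    ∫ y, h y ∂(occupationProb Q x n : Measure X) =
      ((n : ℝ) + 1)⁻¹ * ∑ t ∈ Finset.range (n + 1), ∫ y, h y ∂((Q ^ t) x) := by
  change ∫ y, h y ∂(((n + 1 : ℕ) : ℝ≥0∞)⁻¹ • ∑ t ∈ Finset.range (n + 1), (Q ^ t) x) = _
  rw [integral_smul_measure, integral_finsetSum_measure fun t _ => h.integrable _,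
    ENNReal.toReal_inv, ENNReal.toReal_natCast, Nat.cast_add_one, smul_eq_mul]

/-- The action `h ↦ ∫ h(y) Q(·, dy)` of a Feller kernel on bounded continuous functions. -/
def IsFeller.op (hQ : IsFeller Q) (h : X →ᵇ ℝ) : X →ᵇ ℝ :=
  BoundedContinuousFunction.ofNormedAddCommGroup (fun x => ∫ y, h y ∂(Q x)) (hQ h) ‖h‖
    fun _ => h.norm_integral_le_norm _

lemma IsFeller.integral_bind (hQ : IsFeller Q) (p : Measure X) [IsFiniteMeasure p] (h : X →ᵇ ℝ) :
    ∫ y, h y ∂(p.bind Q) = ∫ y, hQ.op h y ∂p := by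
  have hbind : (Q ∘ₖ Kernel.const Unit p) () = p.bind Q := by
    rw [Kernel.comp_apply, Kernel.const_apply]
  rw [← hbind, Kernel.integral_comp (h.integrable _), Kernel.const_apply]
  rfl

lemma IsFeller.tendsto_integral_op_sub (hQ : IsFeller Q) (x : X) (h : X →ᵇ ℝ) :
    Tendsto (fun n => ∫ y, hQ.op h y ∂(occupationProb Q x n : Measure X) -
      ∫ y, h y ∂(occupationProb Q x n : Measure X)) atTop (𝓝 0) := by
  have htel (n : ℕ) : ∫ y, hQ.op h y ∂(occupationProb Q x n : Measure X) -
      ∫ y, h y ∂(occupationProb Q x n : Measure X) =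
      ((n : ℝ) + 1)⁻¹ * (∫ y, h y ∂((Q ^ (n + 1)) x) - ∫ y, h y ∂((Q ^ 0) x)) := by
    simp_rw [integral_occupationProb, ← hQ.integral_bind, ← pow_succ_apply_eq_bind]
    rw [← mul_sub, ← Finset.sum_sub_distrib,
      Finset.sum_range_sub fun t => ∫ y, h y ∂((Q ^ t) x)]
  have hbound (n : ℕ) : ‖((n : ℝ) + 1)⁻¹ *
      (∫ y, h y ∂((Q ^ (n + 1)) x) - ∫ y, h y ∂((Q ^ 0) x))‖ ≤
      1 / ((n : ℝ) + 1) * (‖h‖ + ‖h‖) := by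
    rw [norm_mul, Real.norm_of_nonneg (by positivity), one_div]
    gcongr
    exact norm_sub_le_of_le (h.norm_integral_le_norm _) (h.norm_integral_le_norm _)
  simp_rw [htel]
  refine squeeze_zero_norm hbound ?_
  simpa using tendsto_one_div_add_atTop_nhds_zero_nat.mul_const (‖h‖ + ‖h‖)

/-- The **Krylov–Bogoliubov theorem**. -/
theorem IsFeller.exists_isStationary [T2Space X] [BorelSpace X] [HasOuterApproxClosed X]
    (hQ : IsFeller Q) {x : X} (ht : IsTightMeasureSet (Set.range fun t : ℕ => (Q ^ t) x)) :
    ∃ ψ : Measure X, IsStationary Q ψ := by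
  have hcompact := isCompact_closure_of_isTightMeasureSet
    (isTightMeasureSet_range_occupationProb ht)
  let U : Ultrafilter ℕ := Ultrafilter.of atTop
  obtain ⟨ψ, -, hψ⟩ := hcompact.ultrafilter_le_nhds (U.map (occupationProb Q x))
    (le_principal_iff.2 (mem_of_superset range_mem_map subset_closure))
  have hlim : Tendsto (occupationProb Q x) U (𝓝 ψ) := hψ
  rw [ProbabilityMeasure.tendsto_iff_forall_integral_tendsto] at hlim
  refine ⟨ψ, inferInstance, ext_of_forall_integral_eq_of_IsFiniteMeasure fun h => ?_⟩
  rw [hQ.integral_bind]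
  refine sub_eq_zero.1 (tendsto_nhds_unique ((hlim (hQ.op h)).sub (hlim h)) ?_)
  exact (hQ.tendsto_integral_op_sub x h).mono_left (Ultrafilter.of_le _)

end Feller

namespace Model

variable {Z E H : Type*} [TopologicalSpace Z] [MeasurableSpace Z] [MeasurableSpace E]
  [MeasurableSpace H] (M : Model Z E H)

/-! ### The exogenous process and the wealth process -/

section MarkovProperty

lemma measurable_E1 {α : Type*} [MeasurableSpace α] {z : α → Z} (hz : Measurable z)
    {g : α → Z × E × H → ℝ≥0∞} (hg : Measurable (Function.uncurry g)) :
    Measurable fun x => M.E1 (z x) (g x) :=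
  Measurable.lintegral_kernel_prod_right' (κ := M.shock.comap z hz) hg

lemma measurable_E1_const {g : Z × E × H → ℝ≥0∞} (hg : Measurable g) :
    Measurable fun z => M.E1 z g :=
  M.measurable_E1 measurable_id (g := fun _ => g) (hg.comp measurable_snd)

lemma E1_fst (z : Z) {f : Z → ℝ≥0∞} (hf : Measurable f) :
    M.E1 z (fun w => f w.1) = ∫⁻ y, f y ∂(M.P z) := by
  rw [E1, shock, Kernel.prod_apply, Kernel.const_apply, lintegral_prod _ (by fun_prop)]
  simp

instance (z : Z) : IsProbabilityMeasure (M.pathLaw z) := by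
  unfold pathLaw
  infer_instance

lemma pathLaw_map_eval_zero (z : Z) :
    (M.pathLaw z).map (fun ω => ω 0) = (Measure.dirac z).prod (M.ν.prod M.μ) := by
  have heval : (fun ω : ℕ → Z × E × H => ω 0) =
      (MeasurableEquiv.piUnique (fun _ : Finset.Iic 0 => Z × E × H)) ∘
        (Preorder.frestrictLe (π := fun _ => Z × E × H) 0) := rfl
  rw [heval, ← Measure.map_map (by fun_prop) (by fun_prop), pathLaw, Kernel.trajMeasure,
    Measure.map_comp _ _ (by fun_prop), Kernel.traj_map_frestrictLe, Kernel.partialTraj_self,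
    Measure.id_comp, Measure.map_map (by fun_prop) (by fun_prop),
    MeasurableEquiv.self_comp_symm, Measure.map_id]

lemma Epath_eval_zero (z : Z) {f : Z → ℝ≥0∞} (hf : Measurable f) :
    M.Epath z (fun ω => f (ω 0).1) = f z := by
  have hmap : M.Epath z (fun ω => f (ω 0).1) =
      ∫⁻ w : Z × E × H, f w.1 ∂((M.pathLaw z).map (fun ω => ω 0)) := by
    rw [lintegral_map (by fun_prop) (by fun_prop)]
    rfl
  rw [hmap, pathLaw_map_eval_zero, lintegral_prod _ (by fun_prop), lintegral_dirac']
  · simp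
  · simpa using hf

-- The Markov property; `hFt` says that `F` depends on the path up to time `t` only.
lemma Epath_succ {α : Type*} [MeasurableSpace α] (z : Z) (t : ℕ) {F : (ℕ → Z × E × H) → α}
    (hF : Measurable F) (hFt : ∀ ω, F (fun i => ω (min i t)) = F ω)
    {g : α → Z × E × H → ℝ≥0∞} (hg : Measurable (Function.uncurry g)) :
    M.Epath z (fun ω => g (F ω) (ω (t + 1))) =
      M.Epath z (fun ω => M.E1 (ω t).1 (g (F ω))) := by
  let extend : ((i : Finset.Iic t) → Z × E × H) → ℕ → Z × E × H :=
    fun h i => h ⟨min i t, Finset.mem_Iic.2 (min_le_right _ _)⟩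
  have hextend : Measurable extend := measurable_pi_lambda _ fun i => measurable_pi_apply _
  have hval (ω) : F (extend (Preorder.frestrictLe t ω)) = F ω := hFt ω
  let G : ((i : Finset.Iic t) → Z × E × H) × (Z × E × H) → ℝ≥0∞ :=
    fun p => g (F (extend p.1)) p.2
  have hG : Measurable G :=
    hg.comp ((hF.comp (hextend.comp measurable_fst)).prodMk measurable_snd)
  have hmap : M.Epath z (fun ω => g (F ω) (ω (t + 1))) =
      ∫⁻ p, G p ∂((M.pathLaw z).map fun ω => (Preorder.frestrictLe t ω, ω (t + 1))) := by
    rw [lintegral_map hG (by fun_prop)]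
    simp only [G, hval]
    rfl
  rw [hmap, pathLaw, ← Kernel.map_frestrictLe_trajMeasure_compProd_eq_map_trajMeasure,
    Measure.lintegral_compProd hG, lintegral_map hG.lintegral_kernel_prod_right' (by fun_prop)]
  simp only [G, hval]
  rfl

lemma Epath_eval_succ (z : Z) (t : ℕ) {g : Z × E × H → ℝ≥0∞} (hg : Measurable g) :
    M.Epath z (fun ω => g (ω (t + 1))) = M.Epath z fun ω => M.E1 (ω t).1 g :=
  M.Epath_succ z t (F := fun _ => ()) measurable_const (fun _ => rfl) (g := fun _ => g)
    (hg.comp measurable_snd)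

lemma Epath_eval_fst_eq (z : Z) (t : ℕ) {f : Z → ℝ≥0∞} (hf : Measurable f) :
    M.Epath z (fun ω => f (ω t).1) = ∫⁻ y, f y ∂(M.P ^ t) z := by
  induction t generalizing f with
  | zero => rw [M.Epath_eval_zero z hf, pow_zero]; exact (Kernel.lintegral_id' hf z).symm
  | succ t ih =>
    have hf1 : Measurable fun w : Z × E × H => f w.1 := hf.comp measurable_fst
    rw [M.Epath_eval_succ z t hf1, ih (M.measurable_E1_const hf1), pow_succ_apply_eq_bind,
      Measure.lintegral_bind M.P.aemeasurable hf.aemeasurable]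
    exact lintegral_congr fun y => M.E1_fst y hf

lemma expInc_succ (t : ℕ) (z : Z) :
    M.expInc (t + 1) z = M.Epath z (fun ω => M.E1 (ω t).1 fun w => M.inc w) :=
  M.Epath_eval_succ z t M.measurable_inc.coe_nnreal_ennreal

variable (c : Policy Z) (a : ℝ≥0)

lemma state_snd (ω : ℕ → Z × E × H) (t : ℕ) : (M.state c a ω t).2 = (ω t).1 := by
  cases t <;> rfl

lemma state_min_eq (ω : ℕ → Z × E × H) {s t : ℕ} (hst : s ≤ t) :
    M.state c a (fun i => ω (min i t)) s = M.state c a ω s := by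
  induction s with
  | zero => simp [state]
  | succ s ih => rw [state, state, ih (by lia), min_eq_left hst]

lemma measurable_state (t : ℕ) : Measurable fun ω : ℕ → Z × E × H => M.state c a ω t := by
  induction t with
  | zero => simp only [state]; fun_prop
  | succ t ih => exact (M.measurable_step c).comp (ih.prodMk (measurable_pi_apply _))

lemma Epath_state_zero (z : Z) {f : ℝ≥0 × Z → ℝ≥0∞} (hf : Measurable f) :
    M.Epath z (fun ω => f (M.state c a ω 0)) = f (a, z) :=
  M.Epath_eval_zero z (f := fun z => f (a, z)) (by fun_prop)

lemma Epath_state_succ (z : Z) (t : ℕ) {g : ℝ≥0 × Z → Z × E × H → ℝ≥0∞}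
    (hg : Measurable (Function.uncurry g)) :
    M.Epath z (fun ω => g (M.state c a ω t) (ω (t + 1))) =
      M.Epath z (fun ω => M.E1 (M.state c a ω t).2 (g (M.state c a ω t))) := by
  simp_rw [state_snd]
  exact M.Epath_succ z t (M.measurable_state c a t) (fun ω => M.state_min_eq c a ω le_rfl) hg

lemma lintegral_stateKernel (s : ℝ≥0 × Z) {f : ℝ≥0 × Z → ℝ≥0∞} (hf : Measurable f) :
    ∫⁻ x, f x ∂(M.stateKernel c s) = M.E1 s.2 (fun w => f (M.step c s w)) := by
  have hstep : Measurable (M.step c s) := (M.measurable_step c).comp measurable_prodMk_left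
  rw [stateKernel_apply, lintegral_map hf hstep]
  rfl

lemma Epath_state_eq (z : Z) (t : ℕ) {f : ℝ≥0 × Z → ℝ≥0∞} (hf : Measurable f) :
    M.Epath z (fun ω => f (M.state c a ω t)) = ∫⁻ s, f s ∂((M.stateKernel c) ^ t) (a, z) := by
  induction t generalizing f with
  | zero => rw [M.Epath_state_zero c a z hf, pow_zero]; exact (Kernel.lintegral_id' hf _).symm
  | succ t ih =>
    have hg : Measurable (Function.uncurry fun s w => f (M.step c s w)) :=
      hf.comp (M.measurable_step c)
    rw [pow_succ_apply_eq_bind,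
      Measure.lintegral_bind (M.stateKernel c).aemeasurable hf.aemeasurable]
    simp_rw [M.lintegral_stateKernel c _ hf]
    rw [← ih (M.measurable_E1 measurable_snd hg)]
    exact M.Epath_state_succ c a z t hg

end MarkovProperty

/-! ### Growth of returns and of wealth -/

section ReturnOperator

/-- The expected-return operator `f ↦ 𝔼_z R̂ f(ẑ)`, whose iterates at `1` are the
`𝔼_z R_1 ⋯ R_n`. -/
def retOp (f : Z → ℝ≥0∞) (z : Z) : ℝ≥0∞ := M.E1 z fun w => M.ret w * f w.1

lemma measurable_ret_mul {f : Z → ℝ≥0∞} (hf : Measurable f) :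
    Measurable fun w : Z × E × H => (M.ret w : ℝ≥0∞) * f w.1 :=
  M.measurable_ret.coe_nnreal_ennreal.mul (hf.comp measurable_fst)

lemma measurable_retOp {f : Z → ℝ≥0∞} (hf : Measurable f) : Measurable (M.retOp f) :=
  M.measurable_E1_const (M.measurable_ret_mul hf)

lemma measurable_retOp_iterate (n : ℕ) {f : Z → ℝ≥0∞} (hf : Measurable f) :
    Measurable (M.retOp^[n] f) := by
  induction n with
  | zero => exact hf
  | succ n ih => rw [Function.iterate_succ_apply']; exact M.measurable_retOp ih

lemma Epath_prod_ret (z : Z) (n : ℕ) {f : Z → ℝ≥0∞} (hf : Measurable f) :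
    M.Epath z (fun ω => (∏ i ∈ Finset.Icc 1 n, (M.ret (ω i) : ℝ≥0∞)) * f (ω n).1) =
      M.retOp^[n] f z := by
  induction n generalizing f with
  | zero => simpa using M.Epath_eval_zero z hf
  | succ n ih =>
    have hret := M.measurable_ret.coe_nnreal_ennreal
    have hmarkov := M.Epath_succ z n
      (F := fun ω => ∏ i ∈ Finset.Icc 1 n, (M.ret (ω i) : ℝ≥0∞))
      (Finset.measurable_fun_prod _ fun i _ => hret.comp (measurable_pi_apply i))
      (fun ω => Finset.prod_congr rfl fun i hi => by
        simp only [min_eq_left (Finset.mem_Icc.1 hi).2])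
      (g := fun x w => x * (M.ret w * f w.1))
      (measurable_fst.mul ((M.measurable_ret_mul hf).comp measurable_snd))
    rw [Function.iterate_succ_apply, ← ih (M.measurable_retOp hf)]
    simp_rw [Finset.prod_Icc_succ_top (Nat.succ_le_succ (Nat.zero_le n)), mul_assoc]
    rw [hmarkov]
    congr 1
    funext ω
    exact lintegral_const_mul _ (M.measurable_ret_mul hf)

lemma expRetProd_eq (n : ℕ) (z : Z) : M.expRetProd n z = M.retOp^[n] 1 z := by
  rw [← M.Epath_prod_ret z n measurable_one]
  simp [expRetProd]

lemma retOp_mono {f g : Z → ℝ≥0∞} (h : f ≤ g) : M.retOp f ≤ M.retOp g :=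
  fun z => lintegral_mono fun w => by gcongr; exact h w.1

lemma retOp_const_mul {f : Z → ℝ≥0∞} (hf : Measurable f) (r : ℝ≥0∞) (z : Z) :
    M.retOp (fun z => r * f z) z = r * M.retOp f z := by
  simp_rw [retOp, E1, mul_left_comm]
  exact lintegral_const_mul _ (M.measurable_ret_mul hf)

lemma retOp_sum {ι : Type*} (s : Finset ι) {f : ι → Z → ℝ≥0∞} (hf : ∀ i, Measurable (f i))
    (z : Z) : M.retOp (fun z => ∑ i ∈ s, f i z) z = ∑ i ∈ s, M.retOp (f i) z := by
  simp_rw [retOp, E1, Finset.mul_sum]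
  exact lintegral_finsetSum _ fun i _ => M.measurable_ret_mul (hf i)

lemma exists_retOp_iterate_le (hbd : M.BoundedMoments) (n : ℕ) :
    ∃ B : ℝ≥0, ∀ z, M.retOp^[n] 1 z ≤ B := by
  induction n with
  | zero => exact ⟨1, fun z => le_rfl⟩
  | succ n ih =>
    obtain ⟨B, hB⟩ := ih
    refine ⟨B * (⨆ z, M.E1 z fun w => M.ret w).toNNReal, fun z => ?_⟩
    calc M.retOp^[n + 1] 1 z = M.retOp (M.retOp^[n] 1) z := by rw [Function.iterate_succ_apply']
      _ ≤ M.retOp (fun _ => B * 1) z := M.retOp_mono (fun z => by simpa using hB z) z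
      _ = B * M.E1 z (fun w => M.ret w) := by
        rw [M.retOp_const_mul measurable_const]
        simp [retOp]
      _ ≤ _ := by
        rw [ENNReal.coe_mul, ENNReal.coe_toNNReal hbd.ret.ne]
        gcongr
        exact le_iSup (fun z => M.E1 z (fun w => M.ret w)) z

/-- A weight `κ` with values in `[1, B]` for which `θ · retOp` is a contraction of modulus `l`. -/
structure IsContractingWeight (θ l B : ℝ≥0) (κ : Z → ℝ≥0∞) : Prop where
  measurable : Measurable κ
  one_le : ∀ z, 1 ≤ κ z
  le_bound : ∀ z, κ z ≤ B
  contract : ∀ z, θ * M.retOp κ z ≤ l * κ z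

/-- The truncated Neumann series `∑_{i < n} q ^ i 𝔼_z R_1 ⋯ R_i`. -/
def returnWeight (q : ℝ≥0) (n : ℕ) (z : Z) : ℝ≥0∞ :=
  ∑ i ∈ Finset.range n, (q : ℝ≥0∞) ^ i * M.retOp^[i] 1 z

lemma mul_retOp_returnWeight_add_one (q : ℝ≥0) (n : ℕ) (z : Z) :
    q * M.retOp (M.returnWeight q n) z + 1 =
      M.returnWeight q n z + (q : ℝ≥0∞) ^ n * M.retOp^[n] 1 z := by
  have hmeas (i : ℕ) := M.measurable_retOp_iterate i (f := 1) measurable_one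
  have hterm (i : ℕ) : (q : ℝ≥0∞) * M.retOp (fun z => (q : ℝ≥0∞) ^ i * M.retOp^[i] 1 z) z =
      (q : ℝ≥0∞) ^ (i + 1) * M.retOp^[i + 1] 1 z := by
    rw [M.retOp_const_mul (hmeas i), Function.iterate_succ_apply', pow_succ', mul_assoc]
  unfold returnWeight
  rw [M.retOp_sum _ fun i => (hmeas i).const_mul _, Finset.mul_sum, ← Finset.sum_range_succ,
    Finset.sum_range_succ']
  simp [hterm]

lemma exists_isContractingWeight (hbd : M.BoundedMoments) {θ : ℝ≥0} {n : ℕ} (hn : 1 ≤ n)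
    (h : (θ : ℝ≥0∞) ^ n * (⨆ z, M.expRetProd n z) < 1) :
    ∃ (κ : Z → ℝ≥0∞) (l B : ℝ≥0), l < 1 ∧ M.IsContractingWeight θ l B κ := by
  obtain ⟨y, hy, hy1⟩ := ENNReal.lt_iff_exists_nnreal_btwn.1 h
  have hy0 : 0 < y := ENNReal.coe_pos.1 (bot_le.trans_lt hy)
  obtain ⟨l, hl0, hl1, hly⟩ : ∃ l : ℝ≥0, 0 < l ∧ l < 1 ∧ l ^ n = y :=
    ⟨y ^ (n⁻¹ : ℝ), NNReal.rpow_pos hy0,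
      NNReal.rpow_lt_one (by exact_mod_cast hy1) (by positivity),
      NNReal.rpow_inv_natCast_pow y (by lia)⟩
  have hθ : (θ : ℝ≥0∞) = l * (θ / l : ℝ≥0) := by
    rw [← ENNReal.coe_mul, mul_div_cancel₀ _ hl0.ne']
  have hlast (z : Z) : ((θ / l : ℝ≥0) : ℝ≥0∞) ^ n * M.retOp^[n] 1 z ≤ 1 := by
    have hlq : (l : ℝ≥0∞) ^ n * (((θ / l : ℝ≥0) : ℝ≥0∞) ^ n * M.retOp^[n] 1 z) ≤
        (l : ℝ≥0∞) ^ n * 1 := by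
      rw [← mul_assoc, ← mul_pow, ← hθ, mul_one, ← expRetProd_eq, ← ENNReal.coe_pow l, hly]
      exact le_trans (by gcongr; exact le_iSup (M.expRetProd n) z) hy.le
    exact (ENNReal.mul_le_mul_iff_right (by simp [hl0.ne']) (by finiteness)).1 hlq
  choose B hB using M.exists_retOp_iterate_le hbd
  refine ⟨M.returnWeight (θ / l) n, l, ∑ i ∈ Finset.range n, (θ / l) ^ i * B i, hl1,
    Finset.measurable_fun_sum _ fun i _ =>
      (M.measurable_retOp_iterate i measurable_one).const_mul _, fun z => ?_, fun z => ?_,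
    fun z => ?_⟩
  · have hfirst := Finset.single_le_sum
      (f := fun i => ((θ / l : ℝ≥0) : ℝ≥0∞) ^ i * M.retOp^[i] 1 z)
      (fun i _ => zero_le) (Finset.mem_range.2 hn)
    rwa [pow_zero, Function.iterate_zero_apply, Pi.one_apply, one_mul] at hfirst
  · push_cast
    exact Finset.sum_le_sum fun i _ => by gcongr; exact hB i z
  · rw [hθ, mul_assoc]
    gcongr
    refine (ENNReal.add_le_add_iff_right ENNReal.one_ne_top).1 ?_
    rw [mul_retOp_returnWeight_add_one]
    gcongr
    exact hlast z

variable {M}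

lemma IsContractingWeight.mul_E1_step_le {b ρ l B : ℝ≥0} {κ : Z → ℝ≥0∞}
    (hκ : M.IsContractingWeight (b * ρ) l B κ) {c : Policy Z} {s : ℝ≥0 × Z}
    (hs : s.1 - c.toFun s ≤ ρ * s.1) :
    b * M.E1 s.2 (fun w => (M.step c s w).1 * κ (M.step c s w).2) ≤
      l * (s.1 * κ s.2) + B * (b * M.E1 s.2 fun w => M.inc w) := by
  have hretκ := M.measurable_ret_mul hκ.measurable
  have hpoint (w : Z × E × H) : ((M.step c s w).1 : ℝ≥0∞) * κ (M.step c s w).2 ≤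
      ρ * s.1 * (M.ret w * κ w.1) + B * M.inc w := by
    have hs' : ((s.1 - c.toFun s : ℝ≥0) : ℝ≥0∞) ≤ ρ * s.1 := by exact_mod_cast hs
    calc ((M.step c s w).1 : ℝ≥0∞) * κ (M.step c s w).2
        = ((s.1 - c.toFun s : ℝ≥0) : ℝ≥0∞) * (M.ret w * κ w.1) + κ w.1 * M.inc w := by
          rw [step, ENNReal.coe_add, ENNReal.coe_mul]
          ring
      _ ≤ ρ * s.1 * (M.ret w * κ w.1) + B * M.inc w := by
          gcongr
          exact hκ.le_bound w.1
  calc b * M.E1 s.2 (fun w => (M.step c s w).1 * κ (M.step c s w).2)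
      ≤ b * M.E1 s.2 (fun w => ρ * s.1 * (M.ret w * κ w.1) + B * M.inc w) := by
        gcongr
        exact lintegral_mono hpoint
    _ = s.1 * ((b * ρ : ℝ≥0) * M.retOp κ s.2) + B * (b * M.E1 s.2 fun w => M.inc w) := by
        rw [E1, lintegral_add_left (hretκ.const_mul _), lintegral_const_mul _ hretκ,
          lintegral_const_mul _ M.measurable_inc.coe_nnreal_ennreal, retOp, E1, E1,
          ENNReal.coe_mul]
        ring
    _ ≤ s.1 * (l * κ s.2) + B * (b * M.E1 s.2 fun w => M.inc w) := by
        exact add_le_add (mul_le_mul_right (hκ.contract s.2) _) le_rfl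
    _ = l * (s.1 * κ s.2) + B * (b * M.E1 s.2 fun w => M.inc w) := by rw [mul_left_comm]

lemma IsContractingWeight.mul_Epath_succ_le {b ρ l B : ℝ≥0} {κ : Z → ℝ≥0∞}
    (hκ : M.IsContractingWeight (b * ρ) l B κ) {c : Policy Z}
    (hρ : ∀ s, s.1 - c.toFun s ≤ ρ * s.1) (a : ℝ≥0) (z : Z) (t : ℕ) :
    b * M.Epath z (fun ω => (M.state c a ω (t + 1)).1 * κ (M.state c a ω (t + 1)).2) ≤
      l * M.Epath z (fun ω => (M.state c a ω t).1 * κ (M.state c a ω t).2) +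
        B * (b * M.expInc (t + 1) z) := by
  have hst := M.measurable_state c a t
  have hstep := M.measurable_step c
  have hκm := hκ.measurable
  have hg : Measurable (Function.uncurry fun (s : ℝ≥0 × Z) (w : Z × E × H) =>
      ((M.step c s w).1 : ℝ≥0∞) * κ (M.step c s w).2) :=
    (measurable_fst.comp hstep).coe_nnreal_ennreal.mul (hκm.comp (measurable_snd.comp hstep))
  have hwealth : Measurable fun ω => ((M.state c a ω t).1 : ℝ≥0∞) * κ (M.state c a ω t).2 := by
    fun_prop
  have hinc : Measurable fun ω : ℕ → Z × E × H => M.E1 (ω t).1 fun w => M.inc w :=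
    (M.measurable_E1_const M.measurable_inc.coe_nnreal_ennreal).comp (by fun_prop)
  have hnext : Measurable fun ω => M.E1 (M.state c a ω t).2 fun w =>
      ((M.step c (M.state c a ω t) w).1 : ℝ≥0∞) * κ (M.step c (M.state c a ω t) w).2 :=
    (M.measurable_E1 measurable_snd hg).comp hst
  refine (congrArg _ (M.Epath_state_succ c a z t hg)).trans_le ?_
  rw [expInc_succ]
  unfold Epath
  rw [← lintegral_const_mul _ hnext, ← lintegral_const_mul _ hwealth, ← lintegral_const_mul _ hinc,
    ← lintegral_const_mul _ (hinc.const_mul _), ← lintegral_add_left (hwealth.const_mul _)]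
  refine lintegral_mono fun ω => ?_
  simpa only [state_snd] using hκ.mul_E1_step_le (hρ (M.state c a ω t))

end ReturnOperator

variable {M}

/-! ### Utility -/

@[simp] lemma u'_zero : M.u' 0 = ⊤ := by simp [u']

lemma u'_of_pos {x : ℝ≥0} (hx : 0 < x) : M.u' x = ENNReal.ofReal (deriv M.uReal x) := by
  simp [u', hx.ne']

lemma u'_ne_top {x : ℝ≥0} (hx : 0 < x) : M.u' x ≠ ⊤ := by
  rw [u'_of_pos hx]
  exact ENNReal.ofReal_ne_top

namespace Utility

lemma u'_pos (hu : M.Utility) (x : ℝ≥0) : 0 < M.u' x := by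
  obtain rfl | hx := eq_zero_or_pos x
  · simp
  · rw [u'_of_pos hx]
    exact ENNReal.ofReal_pos.2 (hu.deriv_pos _ hx)

lemma continuousOn_uReal (hu : M.Utility) : ContinuousOn M.uReal (Set.Ioi 0) :=
  fun x hx => (hu.differentiable x hx).continuousAt.continuousWithinAt

lemma strictAntiOn_deriv (hu : M.Utility) : StrictAntiOn (deriv M.uReal) (Set.Ioi 0) :=
  strictAntiOn_of_deriv_neg (convex_Ioi 0)
    (fun x hx => (hu.differentiable_deriv x hx).continuousAt.continuousWithinAt)
    (fun x hx => hu.deriv2_neg x (by simpa using hx))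

lemma strictAnti_u' (hu : M.Utility) : StrictAnti M.u' := by
  intro x y hxy
  have hy : 0 < y := pos_of_gt hxy
  obtain rfl | hx := eq_zero_or_pos x
  · rw [u'_zero]
    exact (u'_ne_top hy).lt_top
  · rw [u'_of_pos hx, u'_of_pos hy]
    exact (ENNReal.ofReal_lt_ofReal_iff (hu.deriv_pos _ hx)).2 (hu.strictAntiOn_deriv hx hy hxy)

lemma tendsto_u'_zero (hu : M.Utility) : Tendsto M.u' (𝓝 0) (𝓝 ⊤) := by
  have hsplit : 𝓝 (0 : ℝ≥0) = pure 0 ⊔ 𝓝[>] 0 := by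
    rw [← nhdsNE_sup_pure, sup_comm]
    congr 2
    ext
    simp [pos_iff_ne_zero]
  have hcoe : Tendsto (fun x : ℝ≥0 => (x : ℝ)) (𝓝[>] 0) (𝓝[>] 0) :=
    tendsto_nhdsWithin_iff.2 ⟨
      ((NNReal.continuous_coe.tendsto' 0 0 rfl).mono_left nhdsWithin_le_nhds),
      by filter_upwards [self_mem_nhdsWithin] with x hx using hx⟩
  rw [hsplit, tendsto_sup]
  refine ⟨?_, ((ENNReal.tendsto_ofReal_atTop).comp (hu.tendsto_zero.comp hcoe)).congr' ?_⟩
  · rw [← u'_zero (M := M)]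
    exact tendsto_pure_nhds _ _
  · filter_upwards [self_mem_nhdsWithin] with x hx using (u'_of_pos hx).symm

lemma continuous_u' (hu : M.Utility) : Continuous M.u' := by
  refine continuous_iff_continuousAt.2 fun x => ?_
  obtain rfl | hx := eq_zero_or_pos x
  · rw [ContinuousAt, u'_zero]
    exact hu.tendsto_u'_zero
  · have hderiv : ContinuousAt (fun y : ℝ≥0 => deriv M.uReal y) x :=
      ContinuousAt.comp (f := fun y : ℝ≥0 => (y : ℝ))
        (hu.differentiable_deriv x hx).continuousAt NNReal.continuous_coe.continuousAt
    refine (ENNReal.continuous_ofReal.continuousAt.comp hderiv).congr ?_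
    filter_upwards [lt_mem_nhds hx] with y hy using (u'_of_pos hy).symm

lemma exists_u'_eq (hu : M.Utility) {y : ℝ≥0∞} (hy : 0 < y) : ∃ x, M.u' x = y := by
  obtain rfl | hyt := eq_or_ne y ⊤
  · exact ⟨0, u'_zero⟩
  have hlow : ∃ x, M.u' x ≤ y := by
    obtain ⟨x, hx, hx0⟩ := ((hu.tendsto_top.eventually_lt_const
      (ENNReal.toReal_pos hy.ne' hyt)).and (eventually_gt_atTop 0)).exists
    lift x to ℝ≥0 using hx0.le
    refine ⟨x, ?_⟩
    rw [u'_of_pos (mod_cast hx0), ← ENNReal.ofReal_toReal hyt]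
    exact ENNReal.ofReal_le_ofReal hx.le
  exact mem_range_of_exists_le_of_exists_ge hu.continuous_u' hlow ⟨0, by simp⟩

lemma u_eq_uReal (hu : M.Utility) {x : ℝ≥0} (hx : 0 < x) : M.u x = (M.uReal x : EReal) := by
  rw [uReal, Real.toNNReal_coe, EReal.coe_toReal (hu.ne_top x) (hu.ne_bot x hx)]

lemma monotone_u (hu : M.Utility) : Monotone M.u := by
  intro x y hxy
  obtain rfl | hx := eq_zero_or_pos x
  · exact hu.zero_le y
  have hmono : StrictMonoOn M.uReal (Set.Ioi 0) :=
    strictMonoOn_of_deriv_pos (convex_Ioi 0) hu.continuousOn_uReal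
      (fun x hx => hu.deriv_pos x (by simpa using hx))
  rw [hu.u_eq_uReal hx, hu.u_eq_uReal (hx.trans_le hxy), EReal.coe_le_coe_iff]
  exact hmono.monotoneOn hx (hx.trans_le hxy) hxy

lemma strictConcaveOn_uReal (hu : M.Utility) : StrictConcaveOn ℝ (Set.Ioi 0) M.uReal :=
  StrictAntiOn.strictConcaveOn_of_deriv (convex_Ioi 0) hu.continuousOn_uReal
    (by simpa using hu.strictAntiOn_deriv)

lemma uReal_lt_tangent (hu : M.Utility) {x y : ℝ} (hx : 0 < x) (hy : 0 < y) (hxy : y ≠ x) :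
    M.uReal y < M.uReal x + deriv M.uReal x * (y - x) := by
  obtain hlt | hgt := lt_or_gt_of_ne hxy
  · have hslope := hu.strictConcaveOn_uReal.deriv_lt_slope hy hx hlt (hu.differentiable x hx)
    rw [slope_def_field, lt_div_iff₀ (by linarith)] at hslope
    linarith
  · have hslope := hu.strictConcaveOn_uReal.slope_lt_deriv hx hy hgt (hu.differentiable x hx)
    rw [slope_def_field, div_lt_iff₀ (by linarith)] at hslope
    linarith

lemma le_tangent_at_zero (hu : M.Utility) {b s : ℝ} (hb : 0 < b) (hs : M.u 0 = (s : EReal)) :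
    s ≤ M.uReal b + deriv M.uReal b * (0 - b) := by
  have hlim : Tendsto (fun x => M.uReal b + deriv M.uReal b * (x - b)) (𝓝[>] 0)
      (𝓝 (M.uReal b + deriv M.uReal b * (0 - b))) :=
    ((by fun_prop : Continuous fun x => M.uReal b + deriv M.uReal b * (x - b)).tendsto 0).mono_left
      nhdsWithin_le_nhds
  refine ge_of_tendsto hlim ?_
  filter_upwards [Ioo_mem_nhdsGT hb] with x ⟨hx0, hxb⟩
  lift x to ℝ≥0 using hx0.le
  have hsx : s ≤ M.uReal x := by
    have hle := hu.zero_le x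
    rw [hs, hu.u_eq_uReal (mod_cast hx0)] at hle
    exact_mod_cast hle
  exact hsx.trans (hu.uReal_lt_tangent hb hx0 hxb.ne).le

lemma lt_tangent (hu : M.Utility) {c d : ℝ≥0} (hc : 0 < c) (hcd : d ≠ c) {s : ℝ}
    (hs : M.u d = (s : EReal)) :
    s < M.uReal c + deriv M.uReal c * ((d : ℝ) - c) := by
  have hc' : (0 : ℝ) < c := hc
  obtain rfl | hd := eq_zero_or_pos d
  · -- The tangent at `c / 2` lies weakly above `u 0`, and the one at `c` is strictly higher there.
    have hzero := hu.le_tangent_at_zero (half_pos hc') hs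
    have hhalf := hu.uReal_lt_tangent hc' (half_pos hc') (half_lt_self hc').ne
    have hderiv := hu.strictAntiOn_deriv (a := (c : ℝ) / 2) (half_pos hc') hc' (half_lt_self hc')
    rw [NNReal.coe_zero]
    nlinarith
  · have hsd : M.uReal d = s := by
      rw [hu.u_eq_uReal hd] at hs
      exact_mod_cast hs
    rw [← hsd]
    exact hu.uReal_lt_tangent hc hd (NNReal.coe_injective.ne hcd)

-- The inequality `u d + δ ≤ u c + u' c (d - c)` with all terms moved so that no subtraction occurs.
lemma concave_strict (hu : M.Utility) {c d : ℝ≥0} (hc : 0 < c) (hcd : d ≠ c) :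
    ∃ δ : ℝ≥0∞, 0 < δ ∧
      (M.u d).toENNReal + (-M.u c).toENNReal + M.u' c * c + δ ≤
        (M.u c).toENNReal + (-M.u d).toENNReal + M.u' c * d := by
  obtain hd | hd := eq_or_ne (M.u d) ⊥
  · exact ⟨1, one_pos, by simp [hd]⟩
  obtain ⟨s, hs⟩ : ∃ s : ℝ, M.u d = s := ⟨_, (EReal.coe_toReal (hu.ne_top d) hd).symm⟩
  obtain ⟨r, hr⟩ : ∃ r : ℝ, M.uReal c = r := ⟨_, rfl⟩
  obtain ⟨D, hD⟩ : ∃ D : ℝ, deriv M.uReal c = D := ⟨_, rfl⟩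
  have htangent := hu.lt_tangent hc hcd hs
  have hD0 : 0 < D := hD ▸ hu.deriv_pos c hc
  rw [hr, hD] at htangent
  obtain ⟨δ, hδ0, hδ⟩ : ∃ δ > 0, s + δ = r + D * ((d : ℝ) - c) :=
    ⟨_, sub_pos.2 htangent, by ring⟩
  refine ⟨ENNReal.ofReal δ, ENNReal.ofReal_pos.2 hδ0, ?_⟩
  have hparts (x : ℝ) : max x 0 - max (-x) 0 = x := by
    simpa only [max_comm] using max_zero_sub_max_neg_zero_eq_self x
  have hpos (x : ℝ) : (x : EReal).toENNReal = ENNReal.ofReal (max x 0) := by simp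
  rw [hs, hu.u_eq_uReal hc, hr, u'_of_pos hc, hD, ← EReal.coe_neg, ← EReal.coe_neg, hpos, hpos,
    hpos, hpos, ← ENNReal.ofReal_coe_nnreal (p := c), ← ENNReal.ofReal_coe_nnreal (p := d),
    ← ENNReal.ofReal_mul hD0.le, ← ENNReal.ofReal_mul hD0.le]
  repeat rw [← ENNReal.ofReal_add (by positivity) (by positivity)]
  refine ENNReal.ofReal_le_ofReal ?_
  linarith [hparts s, hparts r]

lemma concave (hu : M.Utility) (c d : ℝ≥0) :
    (M.u d).toENNReal + (-M.u c).toENNReal + M.u' c * c ≤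
      (M.u c).toENNReal + (-M.u d).toENNReal + M.u' c * d := by
  obtain rfl | hcd := eq_or_ne d c
  · rfl
  obtain rfl | hc := eq_zero_or_pos c
  · simp [hcd]
  · obtain ⟨δ, -, h⟩ := hu.concave_strict hc hcd
    exact le_self_add.trans h

lemma toENNReal_u_le (hu : M.Utility) (x : ℝ≥0) :
    (M.u x).toENNReal ≤ (M.u 1).toENNReal + M.u' 1 * x := by
  obtain h | h := le_total (M.u x) 0
  · simp [EReal.toENNReal_of_nonpos h]
  · have hconc := hu.concave 1 x
    rw [EReal.toENNReal_of_nonpos (x := -M.u x) (by simpa using h), add_zero] at hconc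
    exact le_self_add.trans (le_self_add.trans hconc)

lemma toENNReal_neg_u_le (hu : M.Utility) (y : ℝ≥0) :
    (-M.u y).toENNReal ≤ (-M.u 1).toENNReal + M.u' y := by
  obtain h | h := le_total 0 (M.u y)
  · simp [EReal.toENNReal_of_nonpos (x := -M.u y) (by simpa using h)]
  · have hconc := hu.concave y 1
    rw [EReal.toENNReal_of_nonpos h, zero_add, ENNReal.coe_one, mul_one] at hconc
    exact le_add_self.trans (le_self_add.trans hconc)

lemma toENNReal_u_ne_top (hu : M.Utility) (x : ℝ≥0) : (M.u x).toENNReal ≠ ⊤ :=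
  mt EReal.toENNReal_eq_top_iff.1 (hu.ne_top x)

lemma toENNReal_neg_u_ne_top (hu : M.Utility) {x : ℝ≥0} (hx : 0 < x) :
    (-M.u x).toENNReal ≠ ⊤ := by
  rw [Ne, EReal.toENNReal_eq_top_iff, EReal.neg_eq_top_iff]
  exact hu.ne_bot x hx

lemma u'_mul_le (hu : M.Utility) {y a : ℝ≥0} (h : y ≤ a) :
    M.u' a * a ≤ M.u' y + M.u' 1 * a := by
  obtain ha | ha := le_total a 1
  · calc M.u' a * a ≤ M.u' a * 1 := by gcongr; exact_mod_cast ha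
      _ ≤ M.u' y := by rw [mul_one]; exact hu.strictAnti_u'.antitone h
      _ ≤ _ := le_self_add
  · calc M.u' a * a ≤ M.u' 1 * a := by gcongr; exact hu.strictAnti_u'.antitone ha
      _ ≤ _ := le_add_self

end Utility

/-! ### Sufficiency of the Euler equation -/

section DiscountedExpectation

variable (M)

/-- The discounted expectation `β ^ t 𝔼_z f`. -/
def discExp (t : ℕ) (z : Z) (f : (ℕ → Z × E × H) → ℝ≥0∞) : ℝ≥0∞ :=
  (M.β : ℝ≥0∞) ^ t * M.Epath z f

variable {M} {t : ℕ} {z : Z} {f g : (ℕ → Z × E × H) → ℝ≥0∞}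

lemma discExp_mono (h : ∀ ω, f ω ≤ g ω) : M.discExp t z f ≤ M.discExp t z g :=
  mul_le_mul_right (lintegral_mono h) _

lemma discExp_add (hf : Measurable f) :
    M.discExp t z (fun ω => f ω + g ω) = M.discExp t z f + M.discExp t z g := by
  rw [discExp, Epath, lintegral_add_left hf, mul_add]
  rfl

lemma discExp_const_mul (hf : Measurable f) (r : ℝ≥0∞) :
    M.discExp t z (fun ω => r * f ω) = r * M.discExp t z f := by
  rw [discExp, Epath, lintegral_const_mul _ hf, mul_left_comm]
  rfl

lemma discExp_const (t : ℕ) (z : Z) (r : ℝ≥0∞) :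
    M.discExp t z (fun _ => r) = (M.β : ℝ≥0∞) ^ t * r := by
  simp [discExp, Epath]

lemma discExp_state_zero (c : Policy Z) (a : ℝ≥0) (z : Z) {f : ℝ≥0 × Z → ℝ≥0∞}
    (hf : Measurable f) : M.discExp 0 z (fun ω => f (M.state c a ω 0)) = f (a, z) := by
  rw [discExp, M.Epath_state_zero c a z hf, pow_zero, one_mul]

lemma Epath_tsum_eq {f : ℕ → (ℕ → Z × E × H) → ℝ≥0∞} (hf : ∀ t, Measurable (f t)) (z : Z) :
    M.Epath z (fun ω => ∑' t, (M.β : ℝ≥0∞) ^ t * f t ω) = ∑' t, M.discExp t z (f t) := by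
  rw [Epath, lintegral_tsum fun t => ((hf t).const_mul _).aemeasurable]
  exact tsum_congr fun t => lintegral_const_mul _ (hf t)

lemma tsum_pow_β_lt_top (M : Model Z E H) : ∑' t : ℕ, (M.β : ℝ≥0∞) ^ t < ⊤ := by
  rw [ENNReal.tsum_geometric, ENNReal.inv_lt_top]
  exact tsub_pos_of_lt (by exact_mod_cast M.β_lt_one)

lemma tendsto_pow_β (M : Model Z E H) : Tendsto (fun t => (M.β : ℝ≥0∞) ^ t) atTop (𝓝 0) :=
  ENNReal.tendsto_pow_atTop_nhds_zero_of_lt_one (by exact_mod_cast M.β_lt_one)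

end DiscountedExpectation

variable {c d : Policy Z}

lemma measurable_wealth (c : Policy Z) (a : ℝ≥0) (t : ℕ) :
    Measurable fun ω : ℕ → Z × E × H => ((M.state c a ω t).1 : ℝ≥0∞) :=
  (measurable_fst.comp (M.measurable_state c a t)).coe_nnreal_ennreal

lemma tsum_wealth_lt_top (hR : M.ReturnGrowth) (hY : M.DiscountedIncome) (hbd : M.BoundedMoments)
    (d : Policy Z) (a : ℝ≥0) (z : Z) :
    ∑' t, M.discExp t z (fun ω => (M.state d a ω t).1) < ⊤ := by
  obtain ⟨n, hn, hlt⟩ := hR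
  obtain ⟨κ, l, B, hl, hκ⟩ := M.exists_isContractingWeight hbd hn hlt
  have hle : ∑' t, M.discExp t z (fun ω => (M.state d a ω t).1) ≤
      ∑' t, M.discExp t z (fun ω => (M.state d a ω t).1 * κ (M.state d a ω t).2) :=
    ENNReal.tsum_le_tsum fun t => discExp_mono fun ω =>
      le_mul_of_one_le_right zero_le (hκ.one_le _)
  refine hle.trans_lt (tsum_lt_top_of_succ_le hl
    (y := fun t => B * ((M.β : ℝ≥0∞) ^ (t + 1) * M.expInc (t + 1) z)) ?_ ?_ fun t => ?_)
  · have hκm := hκ.measurable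
    rw [discExp_state_zero d a z (f := fun s => s.1 * κ s.2) (by fun_prop)]
    exact ENNReal.mul_lt_top ENNReal.coe_lt_top ((hκ.le_bound z).trans_lt ENNReal.coe_lt_top)
  · rw [ENNReal.tsum_mul_left]
    exact ENNReal.mul_lt_top ENNReal.coe_lt_top (hY z)
  · rw [← mul_one M.β] at hκ
    have hsucc := hκ.mul_Epath_succ_le (c := d) (fun s => by simp) a z t
    simp only [discExp, pow_succ, mul_assoc]
    calc _ ≤ (M.β : ℝ≥0∞) ^ t * _ := mul_le_mul_right hsucc _
      _ = _ := by ring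

lemma Epath_u'_inc_le (hu : M.Utility) (z : Z) (t : ℕ) :
    M.Epath z (fun ω => M.u' (M.inc (ω (t + 1)))) ≤ ⨆ z, M.E1 z (fun w => M.u' (M.inc w)) := by
  have hm : Measurable fun w => M.u' (M.inc w) :=
    hu.continuous_u'.measurable.comp M.measurable_inc
  rw [M.Epath_eval_succ z t hm]
  calc _ ≤ M.Epath z (fun _ => ⨆ z, M.E1 z (fun w => M.u' (M.inc w))) :=
        lintegral_mono fun ω => le_iSup (fun z => M.E1 z (fun w => M.u' (M.inc w))) _
    _ = _ := by simp [Epath]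

/-- The expected discounted marginal value of a unit saved at `s` when `c` is followed from the next
period on: the right-hand side `β 𝔼_z R̂ u'(c(â, ẑ))` of the Euler equation. -/
def marginalReturn (M : Model Z E H) (c : Policy Z) (s : ℝ≥0 × Z) : ℝ≥0∞ :=
  M.β * M.E1 s.2 fun w => M.ret w * M.u' (c.toFun (M.step c s w))

/-- A policy that solves the Euler equation (with inequality where all wealth is consumed) and whose
marginal utility exceeds `u'(a)` by a bounded amount. -/
structure IsEuler (M : Model Z E H) (c : Policy Z) : Prop where
  le : ∀ s, M.marginalReturn c s ≤ M.u' (c.toFun s)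
  eq : ∀ s, c.toFun s < s.1 → M.marginalReturn c s = M.u' (c.toFun s)
  bounded : ∃ K < (⊤ : ℝ≥0∞), ∀ s, M.u' (c.toFun s) ≤ M.u' s.1 + K

lemma IsEuler.pos (hc : M.IsEuler c) {s : ℝ≥0 × Z} (hs : 0 < s.1) : 0 < c.toFun s := by
  obtain ⟨K, hKt, hK⟩ := hc.bounded
  refine pos_iff_ne_zero.2 fun h0 => ?_
  have hle := hK s
  rw [h0, u'_zero, top_le_iff] at hle
  exact ENNReal.add_ne_top.2 ⟨u'_ne_top hs, hKt.ne⟩ hle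

/-- `β ^ t 𝔼 u'(c_t) a'_t`, where `a'_t` is wealth under `d`. -/
def margWealth (M : Model Z E H) (c d : Policy Z) (a : ℝ≥0) (z : Z) (t : ℕ) : ℝ≥0∞ :=
  M.discExp t z fun ω => M.u' (c.toFun (M.state c a ω t)) * (M.state d a ω t).1

/-- `β ^ t 𝔼 u'(c_t) d_t`. -/
def margCons (M : Model Z E H) (c d : Policy Z) (a : ℝ≥0) (z : Z) (t : ℕ) : ℝ≥0∞ :=
  M.discExp t z fun ω => M.u' (c.toFun (M.state c a ω t)) * d.toFun (M.state d a ω t)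

/-- `β ^ t 𝔼 u'(c_t) (a'_t - d_t)`. -/
def margSav (M : Model Z E H) (c d : Policy Z) (a : ℝ≥0) (z : Z) (t : ℕ) : ℝ≥0∞ :=
  M.discExp t z fun ω => M.u' (c.toFun (M.state c a ω t)) *
    ((M.state d a ω t).1 - d.toFun (M.state d a ω t) : ℝ≥0)

/-- `β ^ (t + 1) 𝔼 u'(c_{t+1}) Y_{t+1}`. -/
def margInc (M : Model Z E H) (c : Policy Z) (a : ℝ≥0) (z : Z) (t : ℕ) : ℝ≥0∞ :=
  M.discExp (t + 1) z fun ω => M.u' (c.toFun (M.state c a ω (t + 1))) * M.inc (ω (t + 1))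

lemma measurable_u'_state (hu : M.Utility) (c : Policy Z) (a : ℝ≥0) (t : ℕ) :
    Measurable fun ω : ℕ → Z × E × H => M.u' (c.toFun (M.state c a ω t)) :=
  hu.continuous_u'.measurable.comp (c.measurable'.comp (M.measurable_state c a t))

lemma margCons_add_margSav (hu : M.Utility) (a : ℝ≥0) (z : Z) (t : ℕ) :
    M.margCons c d a z t + M.margSav c d a z t = M.margWealth c d a z t := by
  have hcons : Measurable fun ω : ℕ → Z × E × H =>
      M.u' (c.toFun (M.state c a ω t)) * (d.toFun (M.state d a ω t) : ℝ≥0∞) :=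
    (measurable_u'_state hu c a t).mul
      (d.measurable'.comp (M.measurable_state d a t)).coe_nnreal_ennreal
  rw [margCons, margSav, ← discExp_add hcons, margWealth]
  congr 1
  funext ω
  rw [← mul_add, ← ENNReal.coe_add, add_tsub_cancel_of_le (d.le' _)]

lemma discExp_succ_saving (hu : M.Utility) (a : ℝ≥0) (z : Z) (t : ℕ) :
    M.discExp (t + 1) z (fun ω => ((M.state d a ω t).1 - d.toFun (M.state d a ω t) : ℝ≥0) *
        (M.ret (ω (t + 1)) * M.u' (c.toFun (M.state c a ω (t + 1))))) =
      M.discExp t z (fun ω => M.marginalReturn c (M.state c a ω t) *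
        ((M.state d a ω t).1 - d.toFun (M.state d a ω t) : ℝ≥0)) := by
  let k : ℝ≥0 × Z → ℝ≥0 := fun s => s.1 - d.toFun s
  have hk : Measurable k := measurable_fst.sub d.measurable'
  have hret := M.measurable_ret.coe_nnreal_ennreal
  have hnext : Measurable fun p : (ℝ≥0 × Z) × (Z × E × H) =>
      (M.ret p.2 : ℝ≥0∞) * M.u' (c.toFun (M.step c p.1 p.2)) :=
    (hret.comp measurable_snd).mul
      (hu.continuous_u'.measurable.comp (c.measurable'.comp (M.measurable_step c)))
  have hg : Measurable (Function.uncurry fun (x : (ℝ≥0 × Z) × (ℝ≥0 × Z)) (w : Z × E × H) =>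
      (k x.2 : ℝ≥0∞) * (M.ret w * M.u' (c.toFun (M.step c x.1 w)))) :=
    (hk.comp (measurable_snd.comp measurable_fst)).coe_nnreal_ennreal.mul
      (hnext.comp ((measurable_fst.comp measurable_fst).prodMk measurable_snd))
  have hstates : Measurable fun ω : ℕ → Z × E × H => (M.state c a ω t, M.state d a ω t) :=
    (M.measurable_state c a t).prodMk (M.measurable_state d a t)
  have hmarkov := M.Epath_succ z t hstates
    (fun ω => by simp only [M.state_min_eq c a ω le_rfl, M.state_min_eq d a ω le_rfl]) hg
  have hE1 : Measurable fun ω : ℕ → Z × E × H => M.E1 (ω t).1 fun w =>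
      (k (M.state d a ω t) : ℝ≥0∞) * (M.ret w * M.u' (c.toFun (M.step c (M.state c a ω t) w))) :=
    M.measurable_E1 (by fun_prop) (hg.comp (hstates.prodMap measurable_id))
  refine (congrArg _ hmarkov).trans ?_
  rw [discExp, pow_succ, mul_assoc, Epath, ← lintegral_const_mul _ hE1]
  refine congrArg _ (lintegral_congr fun ω => ?_)
  rw [marginalReturn, state_snd, mul_assoc, mul_comm (M.E1 _ _)]
  exact congrArg _ (lintegral_const_mul _ (hnext.comp measurable_prodMk_left))

lemma margWealth_succ (hu : M.Utility) (a : ℝ≥0) (z : Z) (t : ℕ) :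
    M.margWealth c d a z (t + 1) =
      M.discExp t z (fun ω => M.marginalReturn c (M.state c a ω t) *
        ((M.state d a ω t).1 - d.toFun (M.state d a ω t) : ℝ≥0)) + M.margInc c a z t := by
  have hsav : Measurable fun ω : ℕ → Z × E × H =>
      (((M.state d a ω t).1 - d.toFun (M.state d a ω t) : ℝ≥0) : ℝ≥0∞) *
        (M.ret (ω (t + 1)) * M.u' (c.toFun (M.state c a ω (t + 1)))) :=
    ((measurable_fst.sub d.measurable').comp (M.measurable_state d a t)).coe_nnreal_ennreal.mul
      ((M.measurable_ret.comp (measurable_pi_apply _)).coe_nnreal_ennreal.mul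
        (measurable_u'_state hu c a (t + 1)))
  rw [← discExp_succ_saving hu, margInc, ← discExp_add hsav, margWealth]
  congr 1
  funext ω
  simp only [state, step]
  push_cast
  ring

lemma margWealth_succ_le (hc : M.IsEuler c) (hu : M.Utility) (a : ℝ≥0) (z : Z) (t : ℕ) :
    M.margWealth c d a z (t + 1) ≤ M.margSav c d a z t + M.margInc c a z t := by
  rw [margWealth_succ hu]
  exact add_le_add (discExp_mono fun ω => mul_le_mul_left (hc.le _) _) le_rfl

lemma margWealth_succ_eq (hc : M.IsEuler c) (hu : M.Utility) (a : ℝ≥0) (z : Z) (t : ℕ) :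
    M.margWealth c c a z (t + 1) = M.margSav c c a z t + M.margInc c a z t := by
  rw [margWealth_succ hu, margSav]
  congr 2
  funext ω
  obtain h | h := (c.le' (M.state c a ω t)).lt_or_eq
  · rw [hc.eq _ h]
  · simp [h]

lemma sum_margCons_add_margWealth_le (hc : M.IsEuler c) (hu : M.Utility) (a : ℝ≥0) (z : Z)
    (T : ℕ) :
    ∑ t ∈ Finset.range T, M.margCons c d a z t + M.margWealth c d a z T ≤
      ∑ t ∈ Finset.range T, M.margCons c c a z t + M.margWealth c c a z T := by
  induction T with
  | zero => simp [margWealth, state]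
  | succ T ih =>
    rw [Finset.sum_range_succ, Finset.sum_range_succ, margWealth_succ_eq hc hu]
    calc _ ≤ ∑ t ∈ Finset.range T, M.margCons c d a z t + M.margCons c d a z T +
          (M.margSav c d a z T + M.margInc c a z T) := by
          gcongr
          exact margWealth_succ_le hc hu a z T
      _ = ∑ t ∈ Finset.range T, M.margCons c d a z t + M.margWealth c d a z T +
          M.margInc c a z T := by rw [← margCons_add_margSav hu a z T]; ring
      _ ≤ ∑ t ∈ Finset.range T, M.margCons c c a z t + M.margWealth c c a z T +
          M.margInc c a z T := by gcongr
      _ = _ := by rw [← margCons_add_margSav hu a z T]; ring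

lemma margWealth_succ_le_of_bounded (hu : M.Utility) {K : ℝ≥0∞}
    (hK : ∀ s, M.u' (c.toFun s) ≤ M.u' s.1 + K) (a : ℝ≥0) (z : Z) (t : ℕ) :
    M.margWealth c c a z (t + 1) ≤
      (M.β : ℝ≥0∞) ^ (t + 1) * (⨆ z, M.E1 z (fun w => M.u' (M.inc w))) +
        (M.u' 1 + K) * M.discExp (t + 1) z (fun ω => (M.state c a ω (t + 1)).1) := by
  have hinc : Measurable fun ω : ℕ → Z × E × H => M.u' (M.inc (ω (t + 1))) :=
    hu.continuous_u'.measurable.comp (M.measurable_inc.comp (measurable_pi_apply _))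
  have hpoint (ω : ℕ → Z × E × H) :
      M.u' (c.toFun (M.state c a ω (t + 1))) * (M.state c a ω (t + 1)).1 ≤
        M.u' (M.inc (ω (t + 1))) + (M.u' 1 + K) * (M.state c a ω (t + 1)).1 := by
    set s := M.state c a ω (t + 1)
    have hincs : M.inc (ω (t + 1)) ≤ s.1 := le_add_self
    calc M.u' (c.toFun s) * s.1 ≤ (M.u' s.1 + K) * s.1 := by gcongr; exact hK s
      _ = M.u' s.1 * s.1 + K * s.1 := by ring
      _ ≤ M.u' (M.inc (ω (t + 1))) + M.u' 1 * s.1 + K * s.1 := by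
          gcongr; exact hu.u'_mul_le hincs
      _ = _ := by ring
  refine (discExp_mono hpoint).trans ?_
  rw [discExp_add hinc, discExp_const_mul (measurable_wealth c a _)]
  gcongr
  exact mul_le_mul_right (Epath_u'_inc_le hu z t) _

lemma tendsto_margWealth (hu : M.Utility) (hR : M.ReturnGrowth) (hY : M.DiscountedIncome)
    (hbd : M.BoundedMoments) (hc : M.IsEuler c) (a : ℝ≥0) (z : Z) :
    Tendsto (M.margWealth c c a z) atTop (𝓝 0) := by
  obtain ⟨K, hKt, hK⟩ := hc.bounded
  have hwealth := ENNReal.tendsto_atTop_zero_of_tsum_ne_top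
    (tsum_wealth_lt_top hR hY hbd c a z).ne
  have hbound := (ENNReal.Tendsto.mul_const M.tendsto_pow_β (.inr hbd.marg.ne)).add
    (ENNReal.Tendsto.const_mul (a := M.u' 1 + K) hwealth
      (.inr (ENNReal.add_ne_top.2 ⟨u'_ne_top one_pos, hKt.ne⟩)))
  rw [zero_mul, mul_zero, add_zero] at hbound
  rw [← tendsto_add_atTop_iff_nat 1]
  exact tendsto_of_tendsto_of_tendsto_of_le_of_le tendsto_const_nhds
    ((tendsto_add_atTop_iff_nat 1).2 hbound)
    (fun _ => zero_le) (fun t => margWealth_succ_le_of_bounded hu hK a z t)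

lemma margWealth_ne_top (hu : M.Utility) (hR : M.ReturnGrowth) (hY : M.DiscountedIncome)
    (hbd : M.BoundedMoments) (hc : M.IsEuler c) {a : ℝ≥0} (ha : 0 < a) (z : Z) (t : ℕ) :
    M.margWealth c c a z t ≠ ⊤ := by
  obtain ⟨K, hKt, hK⟩ := hc.bounded
  cases t with
  | zero =>
    have hm : Measurable fun s : ℝ≥0 × Z => M.u' (c.toFun s) * (s.1 : ℝ≥0∞) :=
      (hu.continuous_u'.measurable.comp c.measurable').mul (by fun_prop)
    rw [margWealth, discExp_state_zero c a z hm]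
    exact ENNReal.mul_ne_top (ne_top_of_le_ne_top
      (ENNReal.add_ne_top.2 ⟨u'_ne_top ha, hKt.ne⟩) (hK (a, z))) ENNReal.coe_ne_top
  | succ t =>
    refine ne_top_of_le_ne_top ?_ (margWealth_succ_le_of_bounded hu hK a z t)
    have hwealth := ENNReal.ne_top_of_tsum_ne_top (tsum_wealth_lt_top hR hY hbd c a z).ne (t + 1)
    exact ENNReal.add_ne_top.2 ⟨ENNReal.mul_ne_top (by finiteness) hbd.marg.ne,
      ENNReal.mul_ne_top (ENNReal.add_ne_top.2 ⟨u'_ne_top one_pos, hKt.ne⟩) hwealth⟩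

/-- Expected discounted utility in period `t`, positive part. -/
def posUtil (M : Model Z E H) (c : Policy Z) (a : ℝ≥0) (z : Z) (t : ℕ) : ℝ≥0∞ :=
  M.discExp t z fun ω => (M.u (c.toFun (M.state c a ω t))).toENNReal

/-- Expected discounted utility in period `t`, negative part. -/
def negUtil (M : Model Z E H) (c : Policy Z) (a : ℝ≥0) (z : Z) (t : ℕ) : ℝ≥0∞ :=
  M.discExp t z fun ω => (-M.u (c.toFun (M.state c a ω t))).toENNReal

lemma measurable_toENNReal_u (hu : M.Utility) (c : Policy Z) :
    Measurable fun s => (M.u (c.toFun s)).toENNReal :=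
  (hu.monotone_u.measurable.comp c.measurable').ereal_toENNReal

lemma measurable_toENNReal_neg_u (hu : M.Utility) (c : Policy Z) :
    Measurable fun s => (-M.u (c.toFun s)).toENNReal :=
  (hu.monotone_u.measurable.comp c.measurable').neg.ereal_toENNReal

lemma measurable_toENNReal_u_state (hu : M.Utility) (c : Policy Z) (a : ℝ≥0) (t : ℕ) :
    Measurable fun ω : ℕ → Z × E × H => (M.u (c.toFun (M.state c a ω t))).toENNReal :=
  (measurable_toENNReal_u hu c).comp (M.measurable_state c a t)

lemma measurable_toENNReal_neg_u_state (hu : M.Utility) (c : Policy Z) (a : ℝ≥0) (t : ℕ) :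
    Measurable fun ω : ℕ → Z × E × H => (-M.u (c.toFun (M.state c a ω t))).toENNReal :=
  (measurable_toENNReal_neg_u hu c).comp (M.measurable_state c a t)

lemma posUtil_zero (hu : M.Utility) (c : Policy Z) (a : ℝ≥0) (z : Z) :
    M.posUtil c a z 0 = (M.u (c.toFun (a, z))).toENNReal :=
  discExp_state_zero c a z (measurable_toENNReal_u hu c)

lemma negUtil_zero (hu : M.Utility) (c : Policy Z) (a : ℝ≥0) (z : Z) :
    M.negUtil c a z 0 = (-M.u (c.toFun (a, z))).toENNReal :=
  discExp_state_zero c a z (measurable_toENNReal_neg_u hu c)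

lemma margCons_zero (hu : M.Utility) (c d : Policy Z) (a : ℝ≥0) (z : Z) :
    M.margCons c d a z 0 = M.u' (c.toFun (a, z)) * d.toFun (a, z) := by
  have hm : Measurable fun s => M.u' (c.toFun s) * (d.toFun s : ℝ≥0∞) :=
    (hu.continuous_u'.measurable.comp c.measurable').mul d.measurable'.coe_nnreal_ennreal
  exact discExp_state_zero c a z hm

lemma value_eq (hu : M.Utility) (c : Policy Z) (s : ℝ≥0 × Z) :
    M.value c s = ((∑' t, M.posUtil c s.1 s.2 t : ℝ≥0∞) : EReal) -
      ((∑' t, M.negUtil c s.1 s.2 t : ℝ≥0∞) : EReal) := by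
  rw [value, Epath_tsum_eq (measurable_toENNReal_u_state hu c s.1),
    Epath_tsum_eq (measurable_toENNReal_neg_u_state hu c s.1)]
  rfl

lemma posUtil_add_negUtil_add_margCons_le (hu : M.Utility) (c d : Policy Z) (a : ℝ≥0) (z : Z)
    (t : ℕ) :
    M.posUtil d a z t + M.negUtil c a z t + M.margCons c c a z t ≤
      M.posUtil c a z t + M.negUtil d a z t + M.margCons c d a z t := by
  have hsum (e f : Policy Z) : Measurable fun ω : ℕ → Z × E × H =>
      (M.u (e.toFun (M.state e a ω t))).toENNReal + (-M.u (f.toFun (M.state f a ω t))).toENNReal :=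
    (measurable_toENNReal_u_state hu e a t).add (measurable_toENNReal_neg_u_state hu f a t)
  have hexp (e f : Policy Z) (m : (ℕ → Z × E × H) → ℝ≥0∞) :
      M.posUtil e a z t + M.negUtil f a z t + M.discExp t z m = M.discExp t z fun ω =>
        (M.u (e.toFun (M.state e a ω t))).toENNReal +
          (-M.u (f.toFun (M.state f a ω t))).toENNReal + m ω := by
    rw [discExp_add (hsum e f), discExp_add (measurable_toENNReal_u_state hu e a t)]
    rfl
  rw [margCons, margCons, hexp, hexp]
  exact discExp_mono fun ω => hu.concave _ _

lemma tsum_posUtil_lt_top (hu : M.Utility) (hR : M.ReturnGrowth) (hY : M.DiscountedIncome)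
    (hbd : M.BoundedMoments) (d : Policy Z) (a : ℝ≥0) (z : Z) :
    ∑' t, M.posUtil d a z t < ⊤ := by
  have hbound (t : ℕ) : M.posUtil d a z t ≤ (M.β : ℝ≥0∞) ^ t * (M.u 1).toENNReal +
      M.u' 1 * M.discExp t z (fun ω => (M.state d a ω t).1) := by
    rw [← discExp_const, ← discExp_const_mul (measurable_wealth d a t),
      ← discExp_add measurable_const]
    refine discExp_mono fun ω => (hu.toENNReal_u_le _).trans ?_
    gcongr
    exact d.le' _
  refine (ENNReal.tsum_le_tsum hbound).trans_lt ?_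
  rw [ENNReal.tsum_add, ENNReal.tsum_mul_left, ENNReal.tsum_mul_right]
  exact ENNReal.add_lt_top.2 ⟨ENNReal.mul_lt_top M.tsum_pow_β_lt_top
    (hu.toENNReal_u_ne_top 1).lt_top, ENNReal.mul_lt_top (u'_ne_top one_pos).lt_top
    (tsum_wealth_lt_top hR hY hbd d a z)⟩

/-- The policy that consumes all wealth. -/
def consumeAll (Z : Type*) [MeasurableSpace Z] : Policy Z :=
  ⟨Prod.fst, measurable_fst, fun _ => le_rfl⟩

lemma tsum_negUtil_consumeAll_lt_top (hu : M.Utility) (hbd : M.BoundedMoments) {a : ℝ≥0}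
    (ha : 0 < a) (z : Z) : ∑' t, M.negUtil (consumeAll Z) a z t < ⊤ := by
  set S := ⨆ z, M.E1 z (fun w => M.u' (M.inc w))
  have hbound (t : ℕ) : M.negUtil (consumeAll Z) a z (t + 1) ≤
      (M.β : ℝ≥0∞) ^ (t + 1) * ((-M.u 1).toENNReal + S) := by
    have hcons (ω : ℕ → Z × E × H) :
        (consumeAll Z).toFun (M.state (consumeAll Z) a ω (t + 1)) = M.inc (ω (t + 1)) := by
      simp [consumeAll, state, step]
    calc M.negUtil (consumeAll Z) a z (t + 1)
        ≤ M.discExp (t + 1) z fun ω => (-M.u 1).toENNReal + M.u' (M.inc (ω (t + 1))) :=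
          discExp_mono fun ω => by rw [hcons]; exact hu.toENNReal_neg_u_le _
      _ ≤ (M.β : ℝ≥0∞) ^ (t + 1) * ((-M.u 1).toENNReal + S) := by
          rw [discExp_add measurable_const, discExp_const, mul_add]
          gcongr
          exact mul_le_mul_right (Epath_u'_inc_le hu z t) _
  rw [tsum_eq_zero_add' ENNReal.summable, negUtil_zero hu]
  refine ENNReal.add_lt_top.2 ⟨(hu.toENNReal_neg_u_ne_top ha).lt_top,
    (ENNReal.tsum_le_tsum hbound).trans_lt ?_⟩
  rw [ENNReal.tsum_mul_right]
  refine ENNReal.mul_lt_top (lt_of_le_of_lt ?_ M.tsum_pow_β_lt_top)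
    (ENNReal.add_lt_top.2 ⟨(hu.toENNReal_neg_u_ne_top one_pos).lt_top, hbd.marg⟩)
  exact ENNReal.tsum_comp_le_tsum_of_injective (add_left_injective 1) _

-- Summing the tangent inequality along both paths, the marginal terms telescope by the Euler
-- equation and the remainder vanishes by transversality; `δ` is the gain available at time zero.
lemma IsEuler.tsum_util_add_le (hc : M.IsEuler c) (hu : M.Utility) (hR : M.ReturnGrowth)
    (hY : M.DiscountedIncome) (hbd : M.BoundedMoments) (d : Policy Z) {a : ℝ≥0} (ha : 0 < a)
    (z : Z) {δ : ℝ≥0∞}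
    (hδ : (M.u (d.toFun (a, z))).toENNReal + (-M.u (c.toFun (a, z))).toENNReal +
        M.u' (c.toFun (a, z)) * c.toFun (a, z) + δ ≤
      (M.u (c.toFun (a, z))).toENNReal + (-M.u (d.toFun (a, z))).toENNReal +
        M.u' (c.toFun (a, z)) * d.toFun (a, z)) :
    ∑' t, M.posUtil d a z t + ∑' t, M.negUtil c a z t + δ ≤
      ∑' t, M.posUtil c a z t + ∑' t, M.negUtil d a z t := by
  rw [← tsum_pi_single 0 δ, ← ENNReal.tsum_add, ← ENNReal.tsum_add, ← ENNReal.tsum_add]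
  refine tsum_le_tsum_of_add_le_add (C := M.margCons c c a z) (D := M.margCons c d a z)
    (A := M.margWealth c c a z) (fun t => ?_)
    (fun T => le_self_add.trans (sum_margCons_add_margWealth_le hc hu a z T)) (fun t => ?_)
    (tendsto_margWealth hu hR hY hbd hc a z)
  · cases t with
    | zero =>
      simp only [Pi.single_eq_same, posUtil_zero hu, negUtil_zero hu, margCons_zero hu]
      rwa [add_right_comm]
    | succ t =>
      rw [Pi.single_eq_of_ne t.succ_ne_zero, add_zero]
      exact posUtil_add_negUtil_add_margCons_le hu c d a z (t + 1)
  · exact ne_top_of_le_ne_top (margWealth_ne_top hu hR hY hbd hc ha z t)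
      (margCons_add_margSav hu a z t ▸ le_self_add)

lemma IsEuler.tsum_util_le (hc : M.IsEuler c) (hu : M.Utility) (hR : M.ReturnGrowth)
    (hY : M.DiscountedIncome) (hbd : M.BoundedMoments) (d : Policy Z) {a : ℝ≥0} (ha : 0 < a)
    (z : Z) :
    ∑' t, M.posUtil d a z t + ∑' t, M.negUtil c a z t ≤
      ∑' t, M.posUtil c a z t + ∑' t, M.negUtil d a z t := by
  simpa only [add_zero] using hc.tsum_util_add_le hu hR hY hbd d ha z (δ := 0)
    ((add_zero _).trans_le (hu.concave _ _))

lemma IsEuler.tsum_negUtil_lt_top (hc : M.IsEuler c) (hu : M.Utility) (hR : M.ReturnGrowth)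
    (hY : M.DiscountedIncome) (hbd : M.BoundedMoments) {a : ℝ≥0} (ha : 0 < a) (z : Z) :
    ∑' t, M.negUtil c a z t < ⊤ :=
  (le_add_self.trans (hc.tsum_util_le hu hR hY hbd (consumeAll Z) ha z)).trans_lt
    (ENNReal.add_lt_top.2 ⟨tsum_posUtil_lt_top hu hR hY hbd c a z,
      tsum_negUtil_consumeAll_lt_top hu hbd ha z⟩)

lemma IsEuler.value_lt (hc : M.IsEuler c) (hu : M.Utility) (hR : M.ReturnGrowth)
    (hY : M.DiscountedIncome) (hbd : M.BoundedMoments) (d : Policy Z) {s : ℝ≥0 × Z} (hs : 0 < s.1)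
    (hd : d.toFun s ≠ c.toFun s) : M.value d s < M.value c s := by
  obtain ⟨δ, hδ, hgain⟩ := hu.concave_strict (hc.pos hs) hd
  have hneg := (hc.tsum_negUtil_lt_top hu hR hY hbd hs s.2).ne
  have hpos := (tsum_posUtil_lt_top hu hR hY hbd d s.1 s.2).ne
  rw [value_eq hu, value_eq hu]
  exact coe_sub_lt_coe_sub hneg ((ENNReal.lt_add_right (ENNReal.add_ne_top.2 ⟨hpos, hneg⟩)
    hδ.ne').trans_le (hc.tsum_util_add_le hu hR hY hbd d hs s.2 hgain))

theorem IsEuler.isOptimal (hc : M.IsEuler c) (hu : M.Utility) (hR : M.ReturnGrowth)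
    (hY : M.DiscountedIncome) (hbd : M.BoundedMoments) : M.IsOptimal c := by
  intro d s hs
  rw [value_eq hu, value_eq hu]
  exact coe_sub_le_coe_sub (hc.tsum_negUtil_lt_top hu hR hY hbd hs s.2).ne
    (hc.tsum_util_le hu hR hY hbd d hs s.2)

theorem IsEuler.isOptimal_iff (hc : M.IsEuler c) (hu : M.Utility) (hR : M.ReturnGrowth)
    (hY : M.DiscountedIncome) (hbd : M.BoundedMoments) {d : Policy Z} :
    M.IsOptimal d ↔ d = c := by
  refine ⟨fun hd => Policy.ext (funext fun s => ?_), fun h => h ▸ hc.isOptimal hu hR hY hbd⟩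
  obtain h0 | hs := eq_zero_or_pos s.1
  · rw [nonpos_iff_eq_zero.1 ((d.le' s).trans_eq h0), nonpos_iff_eq_zero.1 ((c.le' s).trans_eq h0)]
  · by_contra hne
    exact (hc.value_lt hu hR hY hbd d hs hne).not_ge (hd c s hs)

/-! ### Continuity of conditional expectations -/

section Continuity

variable [TopologicalSpace.PseudoMetrizableSpace Z] [SecondCountableTopology Z] [BorelSpace Z]
  {X : Type*} [TopologicalSpace X] [TopologicalSpace.PseudoMetrizableSpace X]
  [SecondCountableTopology X] [MeasurableSpace X] [BorelSpace X]

lemma lowerSemicontinuous_E1 {z : X → Z} (hz : Continuous z) {F : X → Z × E × H → ℝ≥0∞}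
    (hm : ∀ x, Measurable (F x))
    (hF : ∀ e : E × H, LowerSemicontinuous fun q : X × Z => F q.1 (q.2, e)) :
    LowerSemicontinuous fun x => M.E1 (z x) (F x) := by
  have hE1 (x : X) :
      M.E1 (z x) (F x) = ∫⁻ e, ∫⁻ y, F x (y, e) ∂(M.P (z x)) ∂(M.ν.prod M.μ) := by
    rw [E1, shock, Kernel.prod_apply, Kernel.const_apply,
      lintegral_prod_symm _ (hm x).aemeasurable]
  simp_rw [hE1]
  have hP : Continuous (transitionProb M.P) := isFeller_iff_continuous_transitionProb.1 M.feller_P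
  exact lowerSemicontinuous_lintegral_param (fun x => (hm x).lintegral_prod_left') fun e =>
    lowerSemicontinuous_lintegral_joint (hP.comp hz) (hF e)

-- Both `𝔼 F` and `𝔼 (D - F)` are lower semicontinuous, by Fatou, and their sum is continuous.
lemma continuous_E1_of_le {z : X → Z} (hz : Continuous z) {F D : X → Z × E × H → ℝ≥0∞}
    (hFm : ∀ x, Measurable (F x)) (hDm : ∀ x, Measurable (D x)) (hle : ∀ x w, F x w ≤ D x w)
    (hF : ∀ e : E × H, LowerSemicontinuous fun q : X × Z => F q.1 (q.2, e))
    (hDF : ∀ e : E × H, LowerSemicontinuous fun q : X × Z => D q.1 (q.2, e) - F q.1 (q.2, e))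
    (hD : Continuous fun x => M.E1 (z x) (D x)) (hfin : ∀ x, M.E1 (z x) (D x) ≠ ⊤) :
    Continuous fun x => M.E1 (z x) (F x) := by
  have hsum (x : X) :
      M.E1 (z x) (F x) + M.E1 (z x) (fun w => D x w - F x w) = M.E1 (z x) (D x) := by
    rw [E1, E1, ← lintegral_add_left (hFm x)]
    exact lintegral_congr fun w => add_tsub_cancel_of_le (hle x w)
  have hDFm (x : X) : Measurable fun w => D x w - F x w := (hDm x).sub (hFm x)
  exact continuous_of_lowerSemicontinuous_add (lowerSemicontinuous_E1 hz hFm hF)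
    (lowerSemicontinuous_E1 (M := M) hz hDFm hDF)
    (by simpa only [hsum] using hD) (by simpa only [hsum] using hfin)

end Continuity

/-! ### Time iteration on marginal values -/

/-- `β 𝔼_z R̂ p(R̂ k + Ŷ, ẑ)`: the discounted marginal value of saving `k` at the exogenous state
`z`, when `p` is the marginal value of wealth in the next period. -/
def savMarg (M : Model Z E H) (p : ℝ≥0 × Z → ℝ≥0∞) (k : ℝ≥0) (z : Z) : ℝ≥0∞ :=
  M.β * M.E1 z fun w => M.ret w * p (M.ret w * k + M.inc w, w.1)

section SavMarg

variable {p q : ℝ≥0 × Z → ℝ≥0∞}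

lemma savMarg_mono (h : p ≤ q) (k : ℝ≥0) (z : Z) : M.savMarg p k z ≤ M.savMarg q k z :=
  mul_le_mul_right (lintegral_mono fun _ => mul_le_mul_right (h _) _) _

lemma savMarg_anti (hp : ∀ a b z, a ≤ b → p (b, z) ≤ p (a, z)) {k l : ℝ≥0} (h : k ≤ l) (z : Z) :
    M.savMarg p l z ≤ M.savMarg p k z := by
  refine mul_le_mul_right (lintegral_mono fun w => mul_le_mul_right (hp _ _ _ ?_) _) _
  gcongr

lemma IsContractingWeight.savMarg_le_add {l B : ℝ≥0} {κ : Z → ℝ≥0∞}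
    (hκ : M.IsContractingWeight M.β l B κ) {r : ℝ≥0∞} (h : ∀ s, p s ≤ q s + r * κ s.2)
    (k : ℝ≥0) (z : Z) : M.savMarg p k z ≤ M.savMarg q k z + r * l * κ z := by
  have hm := M.measurable_ret_mul hκ.measurable
  calc M.savMarg p k z
      ≤ M.β * M.E1 z (fun w => M.ret w * q (M.ret w * k + M.inc w, w.1) +
          r * (M.ret w * κ w.1)) := by
        refine mul_le_mul_right (lintegral_mono fun w => ?_) _
        rw [mul_left_comm, ← mul_add]
        exact mul_le_mul_right (h _) _
    _ = M.savMarg q k z + r * (M.β * M.retOp κ z) := by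
        rw [E1, lintegral_add_right _ (hm.const_mul r), lintegral_const_mul _ hm, mul_add,
          mul_left_comm]
        rfl
    _ ≤ M.savMarg q k z + r * (l * κ z) :=
        add_le_add le_rfl (mul_le_mul_right (hκ.contract z) _)
    _ = M.savMarg q k z + r * l * κ z := by rw [mul_assoc]

lemma measurable_nextWealth (k : ℝ≥0) :
    Measurable fun w : Z × E × H => (M.ret w * k + M.inc w, w.1) :=
  ((M.measurable_ret.mul_const k).add M.measurable_inc).prodMk measurable_fst

lemma continuous_nextWealth (hcont : M.ContinuousPrimitives) {X : Type*} [TopologicalSpace X]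
    {k : X → ℝ≥0} (hk : Continuous k) (e : E × H) :
    Continuous fun q : X × Z => (M.ret (q.2, e) * k q.1 + M.inc (q.2, e), q.2) := by
  have hret : Continuous fun y => M.ret (y, e) := hcont.R e.1
  have hinc : Continuous fun y => M.inc (y, e) := hcont.Y e.2
  exact ((hret.comp continuous_snd).mul (hk.comp continuous_fst)).add (hinc.comp continuous_snd)
    |>.prodMk continuous_snd

lemma E1_ret_mul_add_const (M : Model Z E H) (z : Z) {g : Z × E × H → ℝ≥0∞} (hg : Measurable g)
    (C : ℝ≥0∞) : M.E1 z (fun w => M.ret w * (g w + C)) =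
      M.E1 z (fun w => M.ret w * g w) + M.E1 z (fun w => M.ret w) * C := by
  have hret := M.measurable_ret.coe_nnreal_ennreal
  have hm : Measurable fun w => (M.ret w : ℝ≥0∞) * g w := hret.mul hg
  simp_rw [mul_add]
  rw [E1, lintegral_add_left hm, lintegral_mul_const _ hret]
  rfl

lemma continuous_savMarg [TopologicalSpace.PseudoMetrizableSpace Z] [SecondCountableTopology Z]
    [BorelSpace Z] (hu : M.Utility) (hbd : M.BoundedMoments)
    (hcont : M.ContinuousPrimitives) (hp : Continuous p) {C : ℝ≥0∞} (hC : C < ⊤)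
    (hpC : ∀ s, p s ≤ M.u' s.1 + C) : Continuous fun x : ℝ≥0 × Z => M.savMarg p x.1 x.2 := by
  have hu' := hu.continuous_u'
  have hret := M.measurable_ret.coe_nnreal_ennreal
  have hu'm : Measurable fun w => M.u' (M.inc w) := hu'.measurable.comp M.measurable_inc
  have hretc (e : E × H) : Continuous fun x : (ℝ≥0 × Z) × Z => M.ret (x.2, e) :=
    (hcont.R e.1).comp continuous_snd
  have hincc (e : E × H) : Continuous fun x : (ℝ≥0 × Z) × Z => M.inc (x.2, e) :=
    (hcont.Y e.2).comp continuous_snd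
  have hpc (e : E × H) := hp.comp (continuous_nextWealth hcont (continuous_fst (X := ℝ≥0)
    (Y := Z)) e)
  refine (ENNReal.continuous_const_mul ENNReal.coe_ne_top).comp
    (continuous_E1_of_le (D := fun _ w => M.ret w * (M.u' (M.inc w) + C)) continuous_snd
      (fun x => hret.mul (hp.measurable.comp (measurable_nextWealth x.1)))
      (fun _ => hret.mul (hu'm.add_const C)) (fun x w => ?_)
      (fun e => lowerSemicontinuous_coe_mul (hretc e) (hpc e).lowerSemicontinuous)
      (fun e => ?_) ?_ fun x => ?_)
  · exact mul_le_mul_right ((hpC _).trans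
      (add_le_add (hu.strictAnti_u'.antitone le_add_self) le_rfl)) _
  · simp_rw [← ENNReal.mul_sub fun _ _ => ENNReal.coe_ne_top]
    exact lowerSemicontinuous_coe_mul (hretc e) (lowerSemicontinuous_ennreal_sub
      ((hu'.comp (hincc e)).add continuous_const) (hpc e))
  · simp_rw [M.E1_ret_mul_add_const _ hu'm]
    exact (hcont.ret_marg.add ((ENNReal.continuous_mul_const hC.ne).comp hcont.ret)).comp
      continuous_snd
  · rw [M.E1_ret_mul_add_const _ hu'm]
    exact ENNReal.add_ne_top.2 ⟨((le_iSup (fun z => M.E1 z _) x.2).trans_lt hbd.ret_marg).ne,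
      ENNReal.mul_ne_top ((le_iSup (fun z => M.E1 z _) x.2).trans_lt hbd.ret).ne hC.ne⟩

end SavMarg

/-- The time iteration operator on marginal values `p = u' ∘ c`: the value at `(a, z)` is where the
decreasing function `k ↦ β 𝔼_z R̂ p(R̂ k + Ŷ, ẑ)` crosses the increasing function
`k ↦ u'(a - k)`, or `u'(a)` if the savings constraint binds. The minimum over `k` of the larger of
the two covers both cases. -/
def timeIter (M : Model Z E H) (p : ℝ≥0 × Z → ℝ≥0∞) (s : ℝ≥0 × Z) : ℝ≥0∞ :=
  ⨅ k ∈ Set.Iic s.1, max (M.savMarg p k s.2) (M.u' (s.1 - k))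

section TimeIter

variable {p q : ℝ≥0 × Z → ℝ≥0∞}

lemma timeIter_le {s : ℝ≥0 × Z} {k : ℝ≥0} (hk : k ≤ s.1) :
    M.timeIter p s ≤ max (M.savMarg p k s.2) (M.u' (s.1 - k)) :=
  iInf₂_le k hk

lemma timeIter_mono (h : p ≤ q) : M.timeIter p ≤ M.timeIter q :=
  fun s => iInf₂_mono fun k _ => max_le_max (savMarg_mono h k s.2) le_rfl

lemma u'_le_timeIter (hu : M.Utility) (p : ℝ≥0 × Z → ℝ≥0∞) (s : ℝ≥0 × Z) :
    M.u' s.1 ≤ M.timeIter p s :=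
  le_iInf₂ fun _ _ => (hu.strictAnti_u'.antitone tsub_le_self).trans (le_max_right _ _)

lemma timeIter_anti (hu : M.Utility) (p : ℝ≥0 × Z → ℝ≥0∞) {a b : ℝ≥0} (z : Z) (h : a ≤ b) :
    M.timeIter p (b, z) ≤ M.timeIter p (a, z) := by
  refine le_iInf₂ fun k hk => (timeIter_le (s := (b, z)) (le_trans hk h)).trans ?_
  exact max_le_max le_rfl (hu.strictAnti_u'.antitone (tsub_le_tsub_right h k))

lemma timeIter_le_u'_add (p : ℝ≥0 × Z → ℝ≥0∞) (s : ℝ≥0 × Z) :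
    M.timeIter p s ≤ M.u' s.1 + M.savMarg p 0 s.2 := by
  refine (timeIter_le (zero_le (a := s.1))).trans ?_
  rw [tsub_zero]
  exact max_le le_add_self le_self_add

lemma IsContractingWeight.timeIter_le_add {l B : ℝ≥0} {κ : Z → ℝ≥0∞}
    (hκ : M.IsContractingWeight M.β l B κ) {r : ℝ≥0∞} (h : ∀ s, p s ≤ q s + r * κ s.2)
    (s : ℝ≥0 × Z) : M.timeIter p s ≤ M.timeIter q s + r * l * κ s.2 := by
  simp_rw [timeIter, ENNReal.iInf_add]
  refine le_iInf₂ fun k hk => (timeIter_le hk).trans (max_le ?_ ?_)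
  · exact (hκ.savMarg_le_add h k s.2).trans (add_le_add (le_max_left _ _) le_rfl)
  · exact (le_max_right _ _).trans le_self_add

lemma timeIter_eq_iInf_Icc (p : ℝ≥0 × Z → ℝ≥0∞) (s : ℝ≥0 × Z) :
    M.timeIter p s =
      ⨅ t ∈ Set.Icc (0 : ℝ≥0) 1, max (M.savMarg p (t * s.1) s.2) (M.u' (s.1 - t * s.1)) := by
  refine le_antisymm (le_iInf₂ fun t ht => timeIter_le (mul_le_of_le_one_left zero_le ht.2))
    (le_iInf₂ fun k hk => ?_)
  obtain ⟨t, ht, rfl⟩ : ∃ t ∈ Set.Icc (0 : ℝ≥0) 1, t * s.1 = k := by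
    obtain h0 | h0 := eq_or_ne s.1 0
    · exact ⟨0, ⟨le_rfl, zero_le_one⟩, by rw [zero_mul, nonpos_iff_eq_zero.1 (hk.trans_eq h0)]⟩
    · exact ⟨k / s.1, ⟨zero_le, div_le_one_of_le₀ hk zero_le⟩, div_mul_cancel₀ _ h0⟩
  exact iInf₂_le t ht

lemma continuous_timeIter (hu : M.Utility)
    (hp : Continuous fun x : ℝ≥0 × Z => M.savMarg p x.1 x.2) : Continuous (M.timeIter p) := by
  have hu' := hu.continuous_u'
  have hsav : Continuous fun x : (ℝ≥0 × Z) × ℝ≥0 => M.savMarg p (x.2 * x.1.1) x.1.2 :=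
    hp.comp (f := fun x : (ℝ≥0 × Z) × ℝ≥0 => (x.2 * x.1.1, x.1.2)) (by fun_prop)
  have hmax : Continuous ↿(fun (s : ℝ≥0 × Z) (t : ℝ≥0) =>
      max (M.savMarg p (t * s.1) s.2) (M.u' (s.1 - t * s.1))) :=
    hsav.max (hu'.comp (f := fun x : (ℝ≥0 × Z) × ℝ≥0 => x.1.1 - x.2 * x.1.1) (by fun_prop))
  have hinf := (isCompact_Icc (a := (0 : ℝ≥0)) (b := 1)).continuous_sInf hmax
  simp only [sInf_image, ← timeIter_eq_iInf_Icc] at hinf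
  exact hinf

lemma exists_timeIter_eq (hu : M.Utility)
    (hp : Continuous fun x : ℝ≥0 × Z => M.savMarg p x.1 x.2) (s : ℝ≥0 × Z) :
    ∃ k ≤ s.1, M.timeIter p s = max (M.savMarg p k s.2) (M.u' (s.1 - k)) := by
  have hc : Continuous fun k => max (M.savMarg p k s.2) (M.u' (s.1 - k)) :=
    (hp.comp (f := fun k => (k, s.2)) (by fun_prop)).max (hu.continuous_u'.comp (by fun_prop))
  obtain ⟨k, hk, hmin⟩ := (isCompact_Icc (a := (0 : ℝ≥0)) (b := s.1)).exists_isMinOn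
    ⟨0, le_rfl, zero_le⟩ hc.continuousOn
  exact ⟨k, hk.2, le_antisymm (timeIter_le hk.2) (le_iInf₂ fun l hl => hmin ⟨zero_le, hl⟩)⟩

end TimeIter

/-- The iterates of time iteration started at `u'`, that is, from consuming all wealth. -/
def margIter (M : Model Z E H) : ℕ → ℝ≥0 × Z → ℝ≥0∞
  | 0 => fun s => M.u' s.1
  | n + 1 => M.timeIter (margIter M n)

lemma u'_le_margIter (hu : M.Utility) (n : ℕ) (s : ℝ≥0 × Z) : M.u' s.1 ≤ M.margIter n s := by
  cases n with
  | zero => exact le_rfl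
  | succ n => exact u'_le_timeIter hu _ s

lemma monotone_margIter (hu : M.Utility) : Monotone M.margIter := by
  refine monotone_nat_of_le_succ fun n => ?_
  induction n with
  | zero => exact fun s => u'_le_timeIter hu _ s
  | succ n ih => exact timeIter_mono ih

lemma margIter_anti (hu : M.Utility) (n : ℕ) {a b : ℝ≥0} (z : Z) (h : a ≤ b) :
    M.margIter n (b, z) ≤ M.margIter n (a, z) := by
  cases n with
  | zero => exact hu.strictAnti_u'.antitone h
  | succ n => exact timeIter_anti hu _ z h

section Patience

variable {α : ℝ≥0}

lemma savMarg_le_of_patience (hu : M.Utility)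
    (hα : ∀ (a : ℝ≥0) (z : Z), 0 < a →
      M.β * M.E1 z (fun w => M.ret w * M.u' (M.ret w * (1 - α) * a)) ≤ M.u' a)
    {p : ℝ≥0 × Z → ℝ≥0∞} (hp : ∀ s, p s ≤ M.u' (α * s.1)) (s : ℝ≥0 × Z) :
    M.savMarg p ((1 - α) * s.1) s.2 ≤ M.u' (α * s.1) := by
  obtain h0 | h0 := eq_zero_or_pos (α * s.1)
  · rw [h0, u'_zero]
    exact le_top
  · refine le_trans (mul_le_mul_right (lintegral_mono fun w => mul_le_mul_right
      ((hp _).trans (hu.strictAnti_u'.antitone ?_)) _) _) (hα (α * s.1) s.2 h0)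
    calc M.ret w * (1 - α) * (α * s.1) = α * (M.ret w * ((1 - α) * s.1)) := by ring
      _ ≤ α * (M.ret w * ((1 - α) * s.1) + M.inc w) := by gcongr; exact le_self_add

lemma margIter_le_u'_mul (hu : M.Utility) (hα1 : α ≤ 1)
    (hα : ∀ (a : ℝ≥0) (z : Z), 0 < a →
      M.β * M.E1 z (fun w => M.ret w * M.u' (M.ret w * (1 - α) * a)) ≤ M.u' a)
    (n : ℕ) (s : ℝ≥0 × Z) : M.margIter n s ≤ M.u' (α * s.1) := by
  induction n generalizing s with
  | zero => exact hu.strictAnti_u'.antitone (mul_le_of_le_one_left zero_le hα1)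
  | succ n ih =>
    refine (timeIter_le (k := (1 - α) * s.1) (mul_le_of_le_one_left zero_le tsub_le_self)).trans
      (max_le (savMarg_le_of_patience hu hα ih s) ?_)
    refine hu.strictAnti_u'.antitone (le_tsub_of_add_le_left ?_)
    rw [← add_mul, tsub_add_cancel_of_le hα1, one_mul]

end Patience

section Convergence

variable {l B : ℝ≥0} {κ : Z → ℝ≥0∞} {C : ℝ≥0∞}

lemma IsContractingWeight.exists_margIter_le (hκ : M.IsContractingWeight M.β l B κ) (hl : l < 1)
    (hbd : M.BoundedMoments) :
    ∃ C < (⊤ : ℝ≥0∞), ∀ n s, M.margIter n s ≤ M.u' s.1 + C * κ s.2 := by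
  set S := ⨆ z, M.E1 z (fun w => M.ret w * M.u' (M.inc w))
  obtain ⟨C, hCt, hC⟩ := exists_eq_add_mul hbd.ret_marg hl
  have hsav (z : Z) : M.savMarg (fun s => M.u' s.1) 0 z ≤ S * κ z := by
    simp only [savMarg, mul_zero, zero_add]
    calc _ ≤ 1 * M.E1 z (fun w => M.ret w * M.u' (M.inc w)) :=
          mul_le_mul_left (by exact_mod_cast M.β_lt_one.le) _
      _ ≤ 1 * S := by gcongr; exact le_iSup (fun z => M.E1 z _) z
      _ = S := one_mul S
      _ ≤ S * κ z := le_mul_of_one_le_right zero_le (hκ.one_le z)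
  refine ⟨C, hCt, fun n => ?_⟩
  induction n with
  | zero => exact fun s => le_self_add
  | succ n ih =>
    intro s
    refine (timeIter_le_u'_add _ s).trans (add_le_add le_rfl ?_)
    calc _ ≤ M.savMarg (fun s => M.u' s.1) 0 s.2 + C * l * κ s.2 := hκ.savMarg_le_add ih 0 s.2
      _ ≤ S * κ s.2 + C * l * κ s.2 := by gcongr; exact hsav s.2
      _ = (S + l * C) * κ s.2 := by ring
      _ = C * κ s.2 := by rw [← hC]

lemma IsContractingWeight.margIter_add_le (hκ : M.IsContractingWeight M.β l B κ)
    (hC : ∀ n s, M.margIter n s ≤ M.u' s.1 + C * κ s.2) (m n : ℕ) (s : ℝ≥0 × Z) :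
    M.margIter (m + n) s ≤ M.margIter n s + C * (l : ℝ≥0∞) ^ n * κ s.2 := by
  induction n generalizing s with
  | zero => simpa [margIter] using hC m s
  | succ n ih =>
    refine (hκ.timeIter_le_add ih s).trans_eq ?_
    rw [pow_succ, ← mul_assoc]
    rfl

lemma IsContractingWeight.margIter_le_add (hκ : M.IsContractingWeight M.β l B κ) (hu : M.Utility)
    (hC : ∀ n s, M.margIter n s ≤ M.u' s.1 + C * κ s.2) (m n : ℕ) (s : ℝ≥0 × Z) :
    M.margIter m s ≤ M.margIter n s + C * (l : ℝ≥0∞) ^ n * κ s.2 :=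
  (monotone_margIter hu le_self_add s).trans (hκ.margIter_add_le hC m n s)

lemma continuous_margIter [TopologicalSpace.PseudoMetrizableSpace Z] [SecondCountableTopology Z]
    [BorelSpace Z] (hu : M.Utility) (hbd : M.BoundedMoments) (hcont : M.ContinuousPrimitives)
    (hCt : C < ⊤) (hC : ∀ n s, M.margIter n s ≤ M.u' s.1 + C) (n : ℕ) :
    Continuous (M.margIter n) := by
  induction n with
  | zero => exact hu.continuous_u'.comp continuous_fst
  | succ n ih => exact continuous_timeIter hu (continuous_savMarg hu hbd hcont ih hCt (hC n))

/-- The limit of time iteration, the marginal value of wealth under the optimal policy. -/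
def margLimit (M : Model Z E H) (s : ℝ≥0 × Z) : ℝ≥0∞ := ⨆ n, M.margIter n s

lemma IsContractingWeight.timeIter_margLimit (hκ : M.IsContractingWeight M.β l B κ) (hl : l < 1)
    (hu : M.Utility) (hCt : C < ⊤) (hC : ∀ n s, M.margIter n s ≤ M.u' s.1 + C * κ s.2) :
    M.timeIter M.margLimit = M.margLimit := by
  have hle (n : ℕ) (s : ℝ≥0 × Z) : M.margIter n s ≤ M.margLimit s :=
    le_iSup (fun n => M.margIter n s) n
  refine le_antisymm (fun s => ?_) fun s => iSup_le fun n =>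
    (monotone_margIter hu n.le_succ s).trans (timeIter_mono (hle n) s)
  have hκs : κ s.2 ≠ ⊤ := ((hκ.le_bound _).trans_lt ENNReal.coe_lt_top).ne
  have hlim := (tendsto_const_nhds (x := M.margLimit s)).add
    (tendsto_mul_pow_mul_zero (ENNReal.mul_ne_top hCt.ne ENNReal.coe_ne_top : C * l ≠ ⊤) hκs hl)
  rw [add_zero] at hlim
  refine ge_of_tendsto' hlim fun n => ?_
  calc M.timeIter M.margLimit s ≤ M.margIter (n + 1) s + C * (l : ℝ≥0∞) ^ n * l * κ s.2 :=
        hκ.timeIter_le_add (fun s => iSup_le fun m => hκ.margIter_le_add hu hC m n s) s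
    _ ≤ M.margLimit s + C * (l : ℝ≥0∞) ^ n * l * κ s.2 := by gcongr; exact hle (n + 1) s
    _ = M.margLimit s + C * l * (l : ℝ≥0∞) ^ n * κ s.2 := by ring

end Convergence

/-- A fixed point of time iteration with the properties that make it the marginal value of a
candidate policy. -/
structure IsMargFixed (M : Model Z E H) (p : ℝ≥0 × Z → ℝ≥0∞) : Prop where
  continuous : Continuous p
  fixed : M.timeIter p = p
  continuous_savMarg : Continuous fun x : ℝ≥0 × Z => M.savMarg p x.1 x.2
  u'_le : ∀ s, M.u' s.1 ≤ p s
  anti : ∀ a b z, a ≤ b → p (b, z) ≤ p (a, z)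
  bounded : ∃ K < (⊤ : ℝ≥0∞), ∀ s, p s ≤ M.u' s.1 + K

theorem isMargFixed_margLimit [TopologicalSpace.PseudoMetrizableSpace Z]
    [SecondCountableTopology Z] [BorelSpace Z] (hu : M.Utility) (hR : M.ReturnGrowth)
    (hbd : M.BoundedMoments) (hcont : M.ContinuousPrimitives) : M.IsMargFixed M.margLimit := by
  obtain ⟨N, hN, hlt⟩ := hR
  obtain ⟨κ, l, B, hl, hκ⟩ := M.exists_isContractingWeight hbd hN hlt
  obtain ⟨C, hCt, hC⟩ := hκ.exists_margIter_le hl hbd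
  have hCB : C * B < ⊤ := ENNReal.mul_lt_top hCt ENNReal.coe_lt_top
  have hbound (n : ℕ) (s : ℝ≥0 × Z) : M.margIter n s ≤ M.u' s.1 + C * B :=
    (hC n s).trans (add_le_add le_rfl (mul_le_mul_right (hκ.le_bound _) _))
  have hbound' (s : ℝ≥0 × Z) : M.margLimit s ≤ M.u' s.1 + C * B := iSup_le fun n => hbound n s
  have hcontLimit : Continuous M.margLimit :=
    continuous_iSup_of_le_add (continuous_margIter hu hbd hcont hCB hbound)
      (tendsto_mul_pow_mul_zero hCt.ne ENNReal.coe_ne_top hl) fun m n s =>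
        (hκ.margIter_le_add hu hC m n s).trans
          (add_le_add le_rfl (mul_le_mul_right (hκ.le_bound _) _))
  exact
    { continuous := hcontLimit
      fixed := hκ.timeIter_margLimit hl hu hCt hC
      continuous_savMarg := continuous_savMarg hu hbd hcont hcontLimit hCB hbound'
      u'_le := fun s => le_iSup_of_le 0 (u'_le_margIter hu 0 s)
      anti := fun a b z h => iSup_mono fun n => margIter_anti hu n z h
      bounded := ⟨C * B, hCB, hbound'⟩ }

/-! ### The Euler policy -/

namespace IsMargFixed

variable {p : ℝ≥0 × Z → ℝ≥0∞}

lemma exists_policy [SecondCountableTopology Z] [BorelSpace Z] (hp : M.IsMargFixed p)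
    (hu : M.Utility) : ∃ c : Policy Z, Continuous c.toFun ∧ ∀ s, M.u' (c.toFun s) = p s := by
  choose f hf using fun s => hu.exists_u'_eq ((hu.u'_pos s.1).trans_le (hp.u'_le s))
  have hfc : Continuous f :=
    continuous_of_strictAnti_comp hu.strictAnti_u' (by simpa only [hf] using hp.continuous)
  refine ⟨⟨f, hfc.measurable, fun s => hu.strictAnti_u'.le_iff_ge.1 ?_⟩, hfc, hf⟩
  exact (hp.u'_le s).trans_eq (hf s).symm

lemma savMarg_le (hp : M.IsMargFixed p) (hu : M.Utility) {s : ℝ≥0 × Z} {x : ℝ≥0}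
    (hx : M.u' x = p s) : M.savMarg p (s.1 - x) s.2 ≤ p s := by
  obtain ⟨k, hk, hmax⟩ := exists_timeIter_eq hu hp.continuous_savMarg s
  rw [hp.fixed] at hmax
  have hxk : x ≤ s.1 - k :=
    hu.strictAnti_u'.le_iff_ge.1 ((le_max_right _ _).trans_eq (hmax.symm.trans hx.symm))
  calc M.savMarg p (s.1 - x) s.2 ≤ M.savMarg p k s.2 :=
        savMarg_anti hp.anti (le_tsub_of_add_le_left ((le_tsub_iff_right hk).1 hxk)) s.2
    _ ≤ p s := hmax ▸ le_max_left _ _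

-- Saving `k < s.1 - x` leaves `u' (s.1 - k) < p s`, so the fixed point equation puts `p s` below
-- the return on `k`; then `k` tends to `s.1 - x`.
lemma le_savMarg (hp : M.IsMargFixed p) (hu : M.Utility) {s : ℝ≥0 × Z} {x : ℝ≥0}
    (hx : M.u' x = p s) (hxs : x < s.1) : p s ≤ M.savMarg p (s.1 - x) s.2 := by
  have hbelow {k : ℝ≥0} (hk : k < s.1 - x) : p s ≤ M.savMarg p k s.2 := by
    have hmax := timeIter_le (M := M) (p := p) (hk.le.trans tsub_le_self)
    rw [hp.fixed] at hmax
    have hlt : M.u' (s.1 - k) < p s := by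
      rw [← hx]
      exact hu.strictAnti_u' (lt_tsub_comm.1 hk)
    exact (le_max_iff.1 hmax).resolve_right hlt.not_ge
  have hcont : Continuous fun k => M.savMarg p k s.2 :=
    hp.continuous_savMarg.comp (f := fun k => (k, s.2)) (by fun_prop)
  have : (𝓝[<] (s.1 - x)).NeBot := nhdsLT_neBot_of_exists_lt ⟨0, tsub_pos_of_lt hxs⟩
  refine ge_of_tendsto ((hcont.tendsto (s.1 - x)).mono_left
    (nhdsWithin_le_nhds (s := Set.Iio (s.1 - x)))) ?_
  filter_upwards [self_mem_nhdsWithin] with k hk using hbelow hk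

lemma isEuler (hp : M.IsMargFixed p) (hu : M.Utility) (hc : ∀ s, M.u' (c.toFun s) = p s) :
    M.IsEuler c := by
  have hret (s : ℝ≥0 × Z) : M.marginalReturn c s = M.savMarg p (s.1 - c.toFun s) s.2 := by
    simp only [marginalReturn, hc]
    rfl
  refine ⟨fun s => ?_, fun s hs => ?_, ?_⟩
  · rw [hret, hc]
    exact hp.savMarg_le hu (hc s)
  · rw [hret, hc]
    exact le_antisymm (hp.savMarg_le hu (hc s)) (hp.le_savMarg hu (hc s) hs)
  · simpa only [hc] using hp.bounded

lemma candidate (hp : M.IsMargFixed p) (hu : M.Utility) (hcc : Continuous c.toFun)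
    (hc : ∀ s, M.u' (c.toFun s) = p s) : M.Candidate c := by
  obtain ⟨K, hKt, hK⟩ := hp.bounded
  lift K to ℝ≥0 using hKt.ne
  have hpos (s : ℝ≥0 × Z) (hs : 0 < s.1) : 0 < c.toFun s := (hp.isEuler hu hc).pos hs
  refine ⟨hcc.continuousOn, fun a b z _ hab => hu.strictAnti_u'.le_iff_ge.1 ?_, hpos, K,
    fun s hs => ?_⟩
  · rw [hc, hc]
    exact hp.anti a b z hab
  · have hs' : (0 : ℝ) < s.1 := NNReal.coe_pos.2 hs
    have hle : deriv M.uReal (c.toFun s) ≤ deriv M.uReal s.1 + K := by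
      have hd := (hu.deriv_pos _ hs').le
      refine (ENNReal.ofReal_le_ofReal_iff (add_nonneg hd K.coe_nonneg)).1 ?_
      rw [ENNReal.ofReal_add hd K.coe_nonneg, ENNReal.ofReal_coe_nnreal,
        ← u'_of_pos (hpos s hs), ← u'_of_pos hs, hc]
      exact hK s
    have hge : deriv M.uReal s.1 ≤ deriv M.uReal (c.toFun s) :=
      hu.strictAntiOn_deriv.antitoneOn (NNReal.coe_pos.2 (hpos s hs)) hs'
        (NNReal.coe_le_coe.2 (c.le' s))
    rw [abs_of_nonneg (sub_nonneg.2 hge)]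
    linarith

end IsMargFixed

theorem exists_euler_candidate
    [TopologicalSpace.PseudoMetrizableSpace Z] [SecondCountableTopology Z]
    [BorelSpace Z] (hu : M.Utility) (hR : M.ReturnGrowth) (hbd : M.BoundedMoments)
    (hcont : M.ContinuousPrimitives) {α : ℝ≥0} (hα1 : α ≤ 1)
    (hα : ∀ (a : ℝ≥0) (z : Z), 0 < a →
      M.β * M.E1 z (fun w => M.ret w * M.u' (M.ret w * (1 - α) * a)) ≤ M.u' a) :
    ∃ c : Policy Z, Continuous c.toFun ∧ M.Candidate c ∧ M.IsEuler c ∧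
      ∀ s, α * s.1 ≤ c.toFun s := by
  have hp := isMargFixed_margLimit hu hR hbd hcont
  obtain ⟨c, hcc, hc⟩ := hp.exists_policy hu
  refine ⟨c, hcc, hp.candidate hu hcc hc, hp.isEuler hu hc, fun s => ?_⟩
  refine hu.strictAnti_u'.le_iff_ge.1 ?_
  rw [hc]
  exact iSup_le fun n => margIter_le_u'_mul hu hα1 hα n s

/-! ### Stability of the state process -/

lemma isFeller_stateKernel [TopologicalSpace.PseudoMetrizableSpace Z] [SecondCountableTopology Z]
    [BorelSpace Z] (hcont : M.ContinuousPrimitives) (hcc : Continuous c.toFun) :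
    IsFeller (M.stateKernel c) := by
  refine isFeller_of_forall_isOpen_lowerSemicontinuous fun G hG => ?_
  have hGm : Measurable (G.indicator (1 : ℝ≥0 × Z → ℝ≥0∞)) :=
    measurable_one.indicator hG.measurableSet
  have hE1 (s : ℝ≥0 × Z) :
      M.stateKernel c s G = M.E1 s.2 fun w => G.indicator 1 (M.step c s w) := by
    rw [← lintegral_indicator_one hG.measurableSet, M.lintegral_stateKernel c s hGm]
  simp_rw [hE1]
  have hsav : Continuous fun s : ℝ≥0 × Z => s.1 - c.toFun s := continuous_fst.sub hcc
  exact lowerSemicontinuous_E1 continuous_snd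
    (fun s => hGm.comp ((M.measurable_step c).comp measurable_prodMk_left)) fun e =>
      (hG.lowerSemicontinuous_indicator zero_le_one).comp (continuous_nextWealth hcont hsav e)

lemma map_snd_pow_stateKernel (c : Policy Z) (s : ℝ≥0 × Z) (t : ℕ) :
    ((M.stateKernel c ^ t) s).snd = (M.P ^ t) s.2 := by
  refine Measure.ext_of_lintegral _ fun f hf => ?_
  rw [Measure.snd, lintegral_map hf measurable_snd, ← M.Epath_eval_fst_eq s.2 t hf,
    ← M.Epath_state_eq c s.1 s.2 t (f := fun s => f s.2) (hf.comp measurable_snd)]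
  simp_rw [state_snd]

section Stability

variable {α : ℝ≥0} {n : ℕ}

lemma exists_lintegral_wealth_le (hbd : M.BoundedMoments) (hinc : M.BoundedIncome) (hn : 1 ≤ n)
    (hlt : ((1 - α : ℝ≥0) : ℝ≥0∞) ^ n * (⨆ z, M.expRetProd n z) < 1)
    (hc : ∀ s, α * s.1 ≤ c.toFun s) (s : ℝ≥0 × Z) :
    ∃ X < (⊤ : ℝ≥0∞), ∀ t : ℕ, ∫⁻ r, (r.1 : ℝ≥0∞) ∂(M.stateKernel c ^ t) s ≤ X := by
  obtain ⟨κ, l, B, hl, hκ⟩ := M.exists_isContractingWeight hbd hn hlt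
  have hκm := hκ.measurable
  have hρ (r : ℝ≥0 × Z) : r.1 - c.toFun r ≤ (1 - α) * r.1 := by
    rw [tsub_mul, one_mul]
    exact tsub_le_tsub_left (hc r) _
  rw [← one_mul (1 - α)] at hκ
  have hsucc (t : ℕ) := hκ.mul_Epath_succ_le hρ s.1 s.2 t
  simp only [ENNReal.coe_one, one_mul] at hsucc
  obtain ⟨X, hX, hXle⟩ := exists_bound_of_succ_le
    (m := fun t => M.Epath s.2 fun ω => (M.state c s.1 ω t).1 * κ (M.state c s.1 ω t).2) hl
    (by
      rw [M.Epath_state_zero c s.1 s.2 (f := fun r => r.1 * κ r.2) (by fun_prop)]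
      exact ENNReal.mul_lt_top ENNReal.coe_lt_top ((hκ.le_bound _).trans_lt ENNReal.coe_lt_top))
    (ENNReal.mul_lt_top ENNReal.coe_lt_top (hinc s.2)) fun t => (hsucc t).trans
      (add_le_add le_rfl (mul_le_mul_right (le_iSup (fun t : ℕ => M.expInc (t + 1) s.2) t) _))
  refine ⟨X, hX, fun t => ?_⟩
  rw [← M.Epath_state_eq c s.1 s.2 t (f := fun r => r.1) (by fun_prop)]
  exact (lintegral_mono fun ω => le_mul_of_one_le_right zero_le (hκ.one_le _)).trans (hXle t)

theorem boundedInProbability_stateKernel (hbd : M.BoundedMoments) (hinc : M.BoundedIncome)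
    (hP : BoundedInProbability M.P) (hn : 1 ≤ n)
    (hlt : ((1 - α : ℝ≥0) : ℝ≥0∞) ^ n * (⨆ z, M.expRetProd n z) < 1)
    (hc : ∀ s, α * s.1 ≤ c.toFun s) : BoundedInProbability (M.stateKernel c) := by
  intro s
  obtain ⟨X, hX, hmean⟩ := exists_lintegral_wealth_le hbd hinc hn hlt hc s
  refine IsTightMeasureSet.prodMk ?_ ((hP s.2).subset ?_)
  · refine isTightMeasureSet_of_lintegral_le (f := fun x : ℝ≥0 => (x : ℝ≥0∞)) (by fun_prop)
      (fun N => ?_) hX ?_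
    · simp only [ENNReal.coe_le_coe]
      change IsCompact (Set.Iic N)
      exact Set.Icc_bot (a := N) ▸ isCompact_Icc
    · rintro _ ⟨_, ⟨t, rfl⟩, rfl⟩
      rw [Measure.fst, lintegral_map (by fun_prop) measurable_fst]
      exact hmean t
  · rintro _ ⟨_, ⟨t, rfl⟩, rfl⟩
    exact ⟨t, (map_snd_pow_stateKernel c s t).symm⟩

end Stability

end Model

end IncomeFluctuation

end

theorem theoremt_general {Z E H : Type*} [TopologicalSpace Z] [TopologicalSpace.MetrizableSpace Z]
    [SecondCountableTopology Z] [MeasurableSpace Z] [BorelSpace Z] [Nonempty Z]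
    [MeasurableSpace E] [MeasurableSpace H] (M : IncomeFluctuation.Model Z E H)
    (hu : M.Utility) (hR : M.ReturnGrowth) (hY : M.DiscountedIncome) (hbd : M.BoundedMoments)
    (hcont : M.ContinuousPrimitives) (hpat : M.Patience) (hinc : M.BoundedIncome)
    (hP : IncomeFluctuation.BoundedInProbability M.P) :
    ∃ c : IncomeFluctuation.Policy Z,
      M.Candidate c ∧ (∀ d, M.IsOptimal d ↔ d = c) ∧
      IncomeFluctuation.BoundedInProbability (M.stateKernel c) ∧
      ∃ ψ, IncomeFluctuation.IsStationary (M.stateKernel c) ψ := by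
  obtain ⟨α, -, hα1, hα, n, hn, hlt⟩ := hpat
  obtain ⟨c, hcc, hcand, hEuler, hαc⟩ :=
    IncomeFluctuation.Model.exists_euler_candidate hu hR hbd hcont hα1.le hα
  have htight := IncomeFluctuation.Model.boundedInProbability_stateKernel hbd hinc hP hn hlt hαc
  have hFeller := IncomeFluctuation.Model.isFeller_stateKernel hcont hcc
  obtain ⟨z⟩ := ‹Nonempty Z›
  exact ⟨c, hcand, fun d => hEuler.isOptimal_iff hu hR hY hbd, htight,
    hFeller.exists_isStationary (htight (0, z))⟩

theorem theoremt {m : ℕ} (Z : Set (EuclideanSpace ℝ (Fin m))) (hZ : MeasurableSet Z)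
    (hne : Z.Nonempty) {E H : Type*} [MeasurableSpace E] [MeasurableSpace H]
    (M : IncomeFluctuation.Model Z E H)
    (hu : M.Utility) (hR : M.ReturnGrowth) (hY : M.DiscountedIncome) (hbd : M.BoundedMoments)
    (hcont : M.ContinuousPrimitives) (hpat : M.Patience) (hinc : M.BoundedIncome)
    (hP : IncomeFluctuation.BoundedInProbability M.P) :
    ∃ c : IncomeFluctuation.Policy Z,
      (M.Candidate c ∧ M.IsOptimal c ∧
        ∀ d : IncomeFluctuation.Policy Z, M.Candidate d → M.IsOptimal d → d = c) ∧
      IncomeFluctuation.BoundedInProbability (M.stateKernel c) ∧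
      ∃ ψ : MeasureTheory.Measure (NNReal × Z),
        IncomeFluctuation.IsStationary (M.stateKernel c) ψ := by
  have := hne.to_subtype
  obtain ⟨c, hcand, hopt, hstable⟩ := theoremt_general M hu hR hY hbd hcont hpat hinc hP
  exact ⟨c, ⟨hcand, (hopt c).2 rfl, fun d _ => (hopt d).1⟩, hstable⟩
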